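/- Let $d\ge 1$, $\lambda_1,\lambda_2>0$, $\mu\in\mathbf R$, $\mathbf T^d=(-\pi,\pi]^d$ and $\phi\in\mathbf T^d$. Let $\hat H(\phi)$ be the bounded self-adjoint operator on the complex Hilbert space $l_2(\mathbf Z^d)$ given by $$(\hat H(\phi)u)(x)=-\sum_{k=1}^d\Big((\lambda_1e^{-i\phi_k}+\lambda_2)u(x-e_k)+(\lambda_1e^{i\phi_k}+\lambda_2)u(x+e_k)\Big)+2d(\lambda_1+\lambda_2)u(x)+\mu\,\delta_{x,0}\,u(x),$$ where $e_1,\dots,e_d$ are the unit vectors of $\mathbf Z^d$; it is the fibre of the Hamiltonian of two lattice particles with hopping constants $\lambda_1,\lambda_2$ and contact interaction $\mu$. Put $$r(\alpha)=\frac{\sqrt{\lambda_1^2+\lambda_2^2+2\lambda_1\lambda_2\cos\alpha}}{\lambda_1+\lambda_2},\qquad s(\phi)=\#\{k: r(\phi_k)\ne0\},$$ $$c(d,\phi)=\frac1{(2\pi)^d}\int_{\mathbf T^d}\frac{d\psi}{\sum_{k=1}^d r(\phi_k)(1-\cos\psi_k)}\in(0,+\infty],$$ $$\beta_1(\phi)=2(\lambda_1+\lambda_2)\Big(d-\sum_{k=1}^d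 r(\phi_k)\Big),\qquad \beta_2(\phi)=2(\lambda_1+\lambda_2)\Big(d+\sum_{k=1}^d r(\phi_k)\Big),$$ where the integrand of $c(d,\phi)$ is $+\infty$ if its denominator vanishes. Let $\sigma_p$ denote the set of eigenvalues and $\sigma_{ess}$ the essential spectrum (the spectrum without its isolated points that are eigenvalues of finite multiplicity). (a) $\sigma_{ess}(\hat H(\phi))=[\beta_1(\phi),\beta_2(\phi)]$. (b) If $s(\phi)=0$ (that is, $\lambda_1=\lambda_2$ and $\phi=(\pi,\dots,\pi)$), then $\sigma_p(\hat H(\phi))=\{2(\lambda_1+\lambda_2)d,\;2(\lambda_1+\lambda_2)d+\mu\}$. In the rest assume $s(\phi)\ge1$. (c) If $\mu=0$, then $\sigma_p(\hat H(\phi))=\emptyset$. (d) Let $\mu\neq0$ and $\rho=2(\lambda_1+\lambda_2)/\mu$. Say that (E) holds if $\sigma_p(\hat H(\phi))$ consists of exactly one eigenvalue $\nu\in\mathbf R$, and $\nu\notin\sigma_{ess}(\hat H(\phi))$. - For $d=1,2$, (E) holds. - For $d=3,4$: if $\lambda_1=\lambda_2$ and $s(\phi)\le2$, then (E) holds. If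 $\lambda_1\ne\lambda_2$ or $s(\phi)\ge3$, then (E) holds when $|\rho|<c(d,\phi)$, and $\sigma_p(\hat H(\phi))=\emptyset$ when $|\rho|\ge c(d,\phi)$. - For $d\ge5$: if $\lambda_1=\lambda_2$ and $s(\phi)\le2$, then (E) holds. If $\lambda_1=\lambda_2$ and $s(\phi)\in\{3,4\}$, then (E) holds when $|\rho|<c(d,\phi)$, and $\sigma_p(\hat H(\phi))=\emptyset$ when $|\rho|\ge c(d,\phi)$. If $\lambda_1\neq\lambda_2$ or $s(\phi)\ge5$, then (E) holds when $|\rho|<c(d,\phi)$; $\sigma_p(\hat H(\phi))=\{\beta_2(\phi)\}$ when $\rho=c(d,\phi)$; $\sigma_p(\hat H(\phi))=\{\beta_1(\phi)\}$ when $-\rho=c(d,\phi)$; and $\sigma_p(\hat H(\phi))=\emptyset$ when $|\rho|>c(d,\phi)$. In all cases of (d), if $\nu$ is an eigenvalue, then $\nu\ge\beta_2(\phi)$ if $\mu>0$, $\nu\le\beta_1(\phi)$ if $\mu<0$, and $\nu$ is the unique real number for which the integral in the following equation converges absolutely and the equation holds: $$\frac{2(\lambda_1+\lambda_2)}{\mu}=\frac1{(2\pi)^d}\int_{\mathbf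 T^d}\frac{d\psi}{\sum_{k=1}^d r(\phi_k)\cos\psi_k-d+\frac{\nu}{2(\lambda_1+\lambda_2)}}.$$ -/

import Mathlib

noncomputable section

namespace LatticePair

open MeasureTheory

/-- The complex Hilbert space `l₂(ℤ^d)`. -/
abbrev L2Z (d : ℕ) : Type := lp (fun _ : Fin d → ℤ => ℂ) 2

/-- Translation by `y` on `l₂(ℤ^d)`: `(shift y u)(x) = u (x + y)`, a linear isometry. -/
def shift {d : ℕ} (y : Fin d → ℤ) : L2Z d →ₗᵢ[ℂ] L2Z d where
  toFun u := ⟨fun x => u (x + y), memℓp_gen <|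
    ((lp.memℓp u).summable (by norm_num)).comp_injective (add_left_injective y)⟩
  map_add' u v := by ext x; rfl
  map_smul' c u := by ext x; rfl
  norm_map' u := by
    rw [lp.norm_eq_tsum_rpow (by norm_num), lp.norm_eq_tsum_rpow (by norm_num)]
    congr 1
    exact (Equiv.addRight y).tsum_eq (fun x => ‖u x‖ ^ (2 : ENNReal).toReal)

/-- The rank one operator `u ↦ u(0) δ₀` on `l₂(ℤ^d)`. -/
def deltaZero (d : ℕ) : L2Z d →L[ℂ] L2Z d :=
  (lp.singleContinuousLinearMap ℂ (fun _ : Fin d → ℤ => ℂ) 2 0).comp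
    (lp.evalCLM ℂ (fun _ : Fin d → ℤ => ℂ) 2 0)

/-- The unit vector `e_k` of `ℤ^d`. -/
def e {d : ℕ} (k : Fin d) : Fin d → ℤ := Pi.single k 1

/-- The fibre Hamiltonian `Ĥ(φ)` on `l₂(ℤ^d)`; see `hHat_apply` for its action on coordinates. -/
def hHat (d : ℕ) (l₁ l₂ μ : ℝ) (φ : Fin d → ℝ) : L2Z d →L[ℂ] L2Z d :=
  -(∑ k, (((l₁ * Complex.exp (-Complex.I * φ k) + l₂) • (shift (-e k)).toContinuousLinearMap
      + (l₁ * Complex.exp (Complex.I * φ k) + l₂) • (shift (e k)).toContinuousLinearMap)))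
    + ((2 * d * (l₁ + l₂) : ℝ) : ℂ) • ContinuousLinearMap.id ℂ (L2Z d)
    + (μ : ℂ) • deltaZero d

theorem hHat_apply (d : ℕ) (l₁ l₂ μ : ℝ) (φ : Fin d → ℝ) (u : L2Z d) (x : Fin d → ℤ) :
    hHat d l₁ l₂ μ φ u x =
      -(∑ k, ((l₁ * Complex.exp (-Complex.I * φ k) + l₂) * u (x - e k)
          + (l₁ * Complex.exp (Complex.I * φ k) + l₂) * u (x + e k)))
        + 2 * d * (l₁ + l₂) * u x + μ * (if x = 0 then 1 else 0) * u x := by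
  have h0 : deltaZero d u x = (if x = 0 then 1 else 0) * u x := by
    by_cases hx : x = 0
    · subst hx
      simp [deltaZero, lp.evalCLM, lp.evalₗ]
      rfl
    · simp [deltaZero, hx]
  have hs (y : Fin d → ℤ) : (shift y).toContinuousLinearMap u x = u (x + y) := rfl
  simp only [hHat, add_apply, neg_apply,
    sum_apply, smul_apply, lp.coeFn_add, lp.coeFn_neg,
    lp.coeFn_sum, lp.coeFn_smul, Pi.add_apply, Pi.neg_apply, Finset.sum_apply, Pi.smul_apply, h0,
    hs, smul_eq_mul, ContinuousLinearMap.id_apply, ← sub_eq_add_neg]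
  push_cast
  ring

section Spectra

variable {E : Type*} [NormedAddCommGroup E] [NormedSpace ℂ E]

/-- The point spectrum of a bounded operator: the set of its eigenvalues. -/
def pointSpectrum (T : E →L[ℂ] E) : Set ℂ :=
  {z | Module.End.HasEigenvalue (T : E →ₗ[ℂ] E) z}

/-- The discrete spectrum of a (self-adjoint) bounded operator: the eigenvalues of finite
multiplicity that are isolated points of the spectrum. -/
def discreteSpectrum (T : E →L[ℂ] E) : Set ℂ :=
  {z | z ∈ pointSpectrum T ∧ FiniteDimensional ℂ (Module.End.eigenspace (T : E →ₗ[ℂ] E) z) ∧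
    ∃ ε > 0, ∀ w ∈ spectrum ℂ T, dist w z < ε → w = z}

/-- The essential spectrum of a (self-adjoint) bounded operator: the complement of the discrete
spectrum in the spectrum. -/
def essentialSpectrum (T : E →L[ℂ] E) : Set ℂ :=
  spectrum ℂ T \ discreteSpectrum T

end Spectra

/-- The torus `T^d = (-π, π]^d`. -/
def torus (d : ℕ) : Set (Fin d → ℝ) :=
  Set.univ.pi fun _ => Set.Ioc (-Real.pi) Real.pi

/-- `r(α) = √(λ₁² + λ₂² + 2 λ₁ λ₂ cos α) / (λ₁ + λ₂)`. -/
def r (l₁ l₂ α : ℝ) : ℝ :=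
  Real.sqrt (l₁ ^ 2 + l₂ ^ 2 + 2 * l₁ * l₂ * Real.cos α) / (l₁ + l₂)

/-- `s(φ)`: the number of indices `k` with `r(φ_k) ≠ 0`. -/
def s {d : ℕ} (l₁ l₂ : ℝ) (φ : Fin d → ℝ) : ℕ :=
  {k : Fin d | r l₁ l₂ (φ k) ≠ 0}.ncard

/-- `c(d, φ) ∈ [0, ∞]`; the integrand is `∞` wherever its denominator vanishes. -/
def c (d : ℕ) (l₁ l₂ : ℝ) (φ : Fin d → ℝ) : ENNReal :=
  (ENNReal.ofReal ((2 * Real.pi) ^ d))⁻¹ *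
    ∫⁻ ψ in torus d, (ENNReal.ofReal (∑ k, r l₁ l₂ (φ k) * (1 - Real.cos (ψ k))))⁻¹

/-- The lower edge `β₁(φ)`. -/
def β₁ {d : ℕ} (l₁ l₂ : ℝ) (φ : Fin d → ℝ) : ℝ :=
  2 * (l₁ + l₂) * (-(∑ k, r l₁ l₂ (φ k)) + d)

/-- The upper edge `β₂(φ)`. -/
def β₂ {d : ℕ} (l₁ l₂ : ℝ) (φ : Fin d → ℝ) : ℝ :=
  2 * (l₁ + l₂) * (∑ k, r l₁ l₂ (φ k) + d)

/-- The integrand of the eigenvalue equation. -/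
def eigenIntegrand {d : ℕ} (l₁ l₂ : ℝ) (φ : Fin d → ℝ) (ν : ℝ) (ψ : Fin d → ℝ) : ℝ :=
  1 / (∑ k, r l₁ l₂ (φ k) * Real.cos (ψ k) - d + ν / (2 * (l₁ + l₂)))

/-- `ν` is a solution of the integral equation for the eigenvalue; the integral is required to
converge absolutely. -/
def SolvesEigenEquation {d : ℕ} (l₁ l₂ μ : ℝ) (φ : Fin d → ℝ) (ν : ℝ) : Prop :=
  IntegrableOn (eigenIntegrand l₁ l₂ φ ν) (torus d) ∧
    2 * (l₁ + l₂) / μ = 1 / (2 * Real.pi) ^ d * ∫ ψ in torus d, eigenIntegrand l₁ l₂ φ ν ψ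

/-- The point spectrum of `T` consists of exactly one point, which is real and does not belong to
the essential spectrum. -/
def OneEigenvalueOffEssential {E : Type*} [NormedAddCommGroup E] [NormedSpace ℂ E]
    (T : E →L[ℂ] E) : Prop :=
  ∃ ν : ℝ, pointSpectrum T = {(ν : ℂ)} ∧ (ν : ℂ) ∉ essentialSpectrum T

end LatticePair

end

/-! Fourier synthesis turns the fibre operator into multiplication by `2(λ₁+λ₂)(d - X)` plus `μ`
times the projection onto the constants, where `X = ∑ Re (w_k e^{2πi x_k})` and `|w_k| = r(φ_k)`
(`isRankOneModel_hHat`). Let `h` be the multiplier. If `h ≠ z` almost everywhere, the eigenvalue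
equation `(h - z) f = -μ ∫ f` forces `f` to be proportional to `(h - z)⁻¹`. So `z` is an eigenvalue
exactly when `(h - z)⁻¹` is square integrable and `1 + μ ∫ (h - z)⁻¹ = 0`.

Both conditions depend only on the law `P` of `X`. Haar measure absorbs the arguments of the `w_k`,
so `P` is the law of `∑ r(φ_k) cos ψ_k` with independent uniform phases
(`measurePreserving_trigSum`). With `t = ν / (2(λ₁+λ₂)) - d` and `ρ = 2(λ₁+λ₂)/μ`, the conditions
become: `(x + t)⁻¹` lies in `L²(P)` and has mean `ρ` (`mem_pointSpectrum_hHat_iff`).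

Let `S = ∑ r(φ_k)` and `s ≥ 1`. Then `P` is symmetric and atomless, and it puts mass at least of
order `ε` near each interior point of `[-S, S]`; hence the kernel is not integrable for `|t| < S`.
By symmetry take `ρ > 0`; then `t ≥ S`, where the mean decreases strictly from its edge value `c(d,
φ)` to `0`. So there is a solution outside the band iff `|ρ| < c`, one at an edge iff `|ρ| = c`, and
never a second one. Whether the edge solution is an eigenvalue depends on square integrability.
Since `1 - cos` is quadratic at `0`, the `ε`-neighbourhood of an edge has mass of order `ε^{s/2}`:
this makes `c` infinite for `s ≤ 2` (`edgeMean_eq_top`) and the kernel square integrable at the edge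
iff `s ≥ 5` (`memLp_edge_iff`).

For the essential spectrum, wave packets translated far from the origin do not feel the interaction
and put the band into the spectrum (`Icc_subset_spectrum`). Off the band the resolvent is explicit
unless there is an eigenvalue (`IsRankOneModel.notMem_spectrum`), and at most one eigenvalue lies
there. For `s = 0` the operator is diagonal. -/

noncomputable section

namespace LatticePair

open MeasureTheory

/-! ### Resolvent means of a symmetric law on a band -/

section BandLaw

/-- A law on `ℝ` like the distribution of `∑ r_k cos ψ_k` for uniform phases: symmetric, atomless,
carried by the band `[-S, S]`, with non-integrable resolvent kernel inside the band. -/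
structure IsBandLaw (P : Measure ℝ) (S : ℝ) : Prop where
  ae_mem : ∀ᵐ x ∂P, x ∈ Set.Icc (-S) S
  symm : MeasurePreserving (fun x : ℝ => -x) P P
  noAtom : ∀ a, P {a} = 0
  not_integrable : ∀ t, |t| < S → ¬ Integrable (fun x => (x + t)⁻¹) P

/-- `ρ` is the (absolutely convergent) mean of `(x + t)⁻¹` under `P`. -/
def ResolventMean (P : Measure ℝ) (ρ t : ℝ) : Prop :=
  Integrable (fun x => (x + t)⁻¹) P ∧ ρ = ∫ x, (x + t)⁻¹ ∂P

/-- The mean of `(S - x)⁻¹` under `P`, with values in `[0, ∞]`. -/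
def edgeMean (P : Measure ℝ) (S : ℝ) : ENNReal := ∫⁻ x, (ENNReal.ofReal (S - x))⁻¹ ∂P

variable {P : Measure ℝ} {S ρ t t' : ℝ}

theorem IsBandLaw.ae_ne (h : IsBandLaw P S) (a : ℝ) : ∀ᵐ x ∂P, x ≠ a := by
  rw [ae_iff]
  simpa using h.noAtom a

theorem IsBandLaw.ae_pos (h : IsBandLaw P S) (ht : S ≤ t) : ∀ᵐ x ∂P, 0 < x + t := by
  filter_upwards [h.ae_mem, h.ae_ne (-t)] with x hx hne
  have : 0 ≤ x + t := by linarith [hx.1]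
  exact lt_of_le_of_ne this fun h0 => hne (by linarith)

theorem neg_kernel (t : ℝ) : (fun x : ℝ => (x + -t)⁻¹) = fun x => -((-x + t)⁻¹) := by
  funext x
  rw [← inv_neg]
  congr 1
  ring

theorem IsBandLaw.integrable_neg (h : IsBandLaw P S) :
    Integrable (fun x => (x + -t)⁻¹) P ↔ Integrable (fun x => (x + t)⁻¹) P := by
  rw [neg_kernel, integrable_fun_neg_iff]
  exact h.symm.integrable_comp_emb (Homeomorph.neg ℝ).measurableEmbedding
    (g := fun x => (x + t)⁻¹)

theorem IsBandLaw.integral_neg (h : IsBandLaw P S) :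
    ∫ x, (x + -t)⁻¹ ∂P = -∫ x, (x + t)⁻¹ ∂P := by
  rw [neg_kernel, MeasureTheory.integral_neg]
  congr 1
  exact h.symm.integral_comp (Homeomorph.neg ℝ).measurableEmbedding (fun x => (x + t)⁻¹)

theorem IsBandLaw.memLp_neg (h : IsBandLaw P S) :
    MemLp (fun x => (x + -t)⁻¹) 2 P ↔ MemLp (fun x => (x + t)⁻¹) 2 P := by
  have key (t : ℝ) : MemLp (fun x => (x + t)⁻¹) 2 P → MemLp (fun x => (x + -t)⁻¹) 2 P := by
    intro hm
    rw [neg_kernel]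
    exact (hm.comp_measurePreserving h.symm).neg
  exact ⟨fun hm => by simpa using key (-t) hm, key t⟩

/-- The symmetry of the law reduces attractive interaction (`ρ < 0`) to repulsive (`ρ > 0`). -/
theorem IsBandLaw.resolventMean_neg (h : IsBandLaw P S) :
    ResolventMean P (-ρ) (-t) ↔ ResolventMean P ρ t := by
  unfold ResolventMean
  rw [h.integrable_neg, h.integral_neg, neg_inj]

theorem IsBandLaw.integral_strictAnti [IsProbabilityMeasure P] (h : IsBandLaw P S) (hS : S ≤ t)
    (htt : t < t') (hi : Integrable (fun x => (x + t)⁻¹) P)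
    (hi' : Integrable (fun x => (x + t')⁻¹) P) :
    ∫ x, (x + t')⁻¹ ∂P < ∫ x, (x + t)⁻¹ ∂P := by
  have hlt : ∀ᵐ x ∂P, (x + t')⁻¹ < (x + t)⁻¹ := by
    filter_upwards [h.ae_pos hS] with x hx
    exact inv_strictAnti₀ hx (by linarith)
  refine lt_of_le_of_ne (integral_mono_ae hi' hi (hlt.mono fun x hx => hx.le)) fun heq => ?_
  have h0 : ∫ x, ((x + t)⁻¹ - (x + t')⁻¹) ∂P = 0 := by
    rw [integral_sub hi hi', heq, sub_self]
  rw [integral_eq_zero_iff_of_nonneg_ae (hlt.mono fun x hx => sub_nonneg.2 hx.le)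
    (hi.sub hi')] at h0
  have : ∀ᵐ _ ∂P, False := by
    filter_upwards [h0, hlt] with x h1 h2
    have : (x + t)⁻¹ - (x + t')⁻¹ = 0 := h1
    linarith
  exact this.exists.elim fun _ hx => hx

/-- Inside the band the kernel is not integrable, and for `t ≤ -S` it is negative almost everywhere,
so its mean cannot be positive. -/
theorem IsBandLaw.le_of_resolventMean (h : IsBandLaw P S) (hρ : 0 < ρ)
    (hs : ResolventMean P ρ t) : S ≤ t := by
  by_contra! hlt
  by_cases hm : -S < t
  · exact h.not_integrable t (abs_lt.2 ⟨hm, hlt⟩) hs.1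
  · have h1 : 0 ≤ ∫ x, (x + -t)⁻¹ ∂P :=
      integral_nonneg_of_ae ((h.ae_pos (t := -t) (by linarith)).mono fun x hx =>
        (inv_pos.2 hx).le)
    rw [h.integral_neg, ← hs.2] at h1
    linarith

theorem IsBandLaw.resolventMean_unique_of_pos [IsProbabilityMeasure P] (h : IsBandLaw P S)
    (hρ : 0 < ρ) (hs : ResolventMean P ρ t) (hs' : ResolventMean P ρ t') : t = t' := by
  have h1 := h.le_of_resolventMean hρ hs
  have h2 := h.le_of_resolventMean hρ hs'
  rcases lt_trichotomy t t' with hlt | heq | hlt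
  · have := h.integral_strictAnti h1 hlt hs.1 hs'.1
    rw [← hs.2, ← hs'.2] at this
    exact absurd this (lt_irrefl _)
  · exact heq
  · have := h.integral_strictAnti h2 hlt hs'.1 hs.1
    rw [← hs.2, ← hs'.2] at this
    exact absurd this (lt_irrefl _)

theorem IsBandLaw.resolventMean_unique [IsProbabilityMeasure P] (h : IsBandLaw P S)
    (hρ : ρ ≠ 0) (hs : ResolventMean P ρ t) (hs' : ResolventMean P ρ t') : t = t' := by
  rcases lt_or_gt_of_ne hρ with hneg | hpos
  · have := h.resolventMean_unique_of_pos (neg_pos.2 hneg) (h.resolventMean_neg.2 hs)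
      (h.resolventMean_neg.2 hs')
    linarith
  · exact h.resolventMean_unique_of_pos hpos hs hs'

/-- Reflection reconciles the kernel `(S - x)⁻¹` that occurs in `c(d, φ)` with the kernel `(x +
t)⁻¹` at `t = S`. -/
theorem IsBandLaw.edgeMean_eq (h : IsBandLaw P S) :
    edgeMean P S = ∫⁻ x, ENNReal.ofReal ((x + S)⁻¹) ∂P := by
  unfold edgeMean
  rw [← h.symm.lintegral_comp (f := fun x => (ENNReal.ofReal (S - x))⁻¹) (by fun_prop)]
  refine lintegral_congr_ae ?_
  filter_upwards [h.ae_pos le_rfl] with x hx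
  rw [ENNReal.ofReal_inv_of_pos hx]
  congr 2
  ring

theorem kernel_measurable (t : ℝ) : Measurable fun x : ℝ => (x + t)⁻¹ := by fun_prop

theorem IsBandLaw.ofReal_integral (h : IsBandLaw P S) (ht : S ≤ t)
    (hi : Integrable (fun x => (x + t)⁻¹) P) :
    ENNReal.ofReal (∫ x, (x + t)⁻¹ ∂P) = ∫⁻ x, ENNReal.ofReal ((x + t)⁻¹) ∂P :=
  ofReal_integral_eq_lintegral_ofReal hi ((h.ae_pos ht).mono fun _ hx => (inv_pos.2 hx).le)

theorem IsBandLaw.integrable_edge_iff (h : IsBandLaw P S) :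
    Integrable (fun x => (x + S)⁻¹) P ↔ edgeMean P S ≠ ⊤ := by
  rw [h.edgeMean_eq, ← lt_top_iff_ne_top]
  exact ⟨fun hi => hi.lintegral_lt_top, fun hlt =>
    (lintegral_ofReal_ne_top_iff_integrable (kernel_measurable S).aestronglyMeasurable
      ((h.ae_pos le_rfl).mono fun _ hx => (inv_pos.2 hx).le)).1 hlt.ne⟩

theorem IsBandLaw.resolventMean_edge_iff (h : IsBandLaw P S) (hρ : 0 < ρ) :
    ResolventMean P ρ S ↔ edgeMean P S = ENNReal.ofReal ρ := by
  constructor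
  · rintro ⟨hi, rfl⟩
    rw [h.ofReal_integral le_rfl hi, h.edgeMean_eq]
  · intro he
    have hi := h.integrable_edge_iff.2 (he ▸ ENNReal.ofReal_ne_top)
    refine ⟨hi, ?_⟩
    rw [h.edgeMean_eq, ← h.ofReal_integral le_rfl hi] at he
    have h0 : 0 ≤ ∫ x, (x + S)⁻¹ ∂P :=
      integral_nonneg_of_ae ((h.ae_pos le_rfl).mono fun _ hx => (inv_pos.2 hx).le)
    exact ((ENNReal.ofReal_eq_ofReal_iff h0 hρ.le).1 he).symm

theorem IsBandLaw.lt_edgeMean [IsProbabilityMeasure P] (h : IsBandLaw P S) (ht : S < t)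
    (hρ : 0 < ρ) (hs : ResolventMean P ρ t) : ENNReal.ofReal ρ < edgeMean P S := by
  by_cases he : edgeMean P S = ⊤
  · rw [he]
    exact ENNReal.ofReal_lt_top
  · have hi := h.integrable_edge_iff.2 he
    have := h.integral_strictAnti le_rfl ht hi hs.1
    rw [← hs.2] at this
    rw [h.edgeMean_eq, ← h.ofReal_integral le_rfl hi]
    exact (ENNReal.ofReal_lt_ofReal_iff (hρ.trans this)).2 this

theorem IsBandLaw.ae_norm_le (h : IsBandLaw P S) (ht : S < t) :
    ∀ᵐ x ∂P, ‖(x + t)⁻¹‖ ≤ (t - S)⁻¹ := by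
  filter_upwards [h.ae_mem] with x hx
  have h1 : 0 < t - S := by linarith
  have h2 : t - S ≤ x + t := by linarith [hx.1]
  rw [norm_inv, Real.norm_of_nonneg (h1.le.trans h2)]
  exact inv_anti₀ h1 h2

theorem IsBandLaw.memLp_outside [IsProbabilityMeasure P] (h : IsBandLaw P S) (ht : S < t) :
    MemLp (fun x => (x + t)⁻¹) 2 P :=
  MemLp.of_bound (kernel_measurable t).aestronglyMeasurable _ (h.ae_norm_le ht)

theorem IsBandLaw.integrable_outside [IsProbabilityMeasure P] (h : IsBandLaw P S) (ht : S < t) :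
    Integrable (fun x => (x + t)⁻¹) P :=
  (h.memLp_outside ht).integrable (by norm_num)

theorem IsBandLaw.continuousOn_integral [IsProbabilityMeasure P] (h : IsBandLaw P S) {a : ℝ}
    (ha : S < a) : ContinuousOn (fun t => ∫ x, (x + t)⁻¹ ∂P) (Set.Ici a) := by
  refine continuousOn_of_dominated (bound := fun _ => (a - S)⁻¹)
    (fun t _ => (kernel_measurable t).aestronglyMeasurable) (fun t ht => ?_)
    (integrable_const _) ?_
  · filter_upwards [h.ae_norm_le (lt_of_lt_of_le ha ht)] with x hx
    exact hx.trans (inv_anti₀ (by linarith) (sub_le_sub_right ht S))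
  · filter_upwards [h.ae_mem] with x hx
    refine ContinuousOn.inv₀ (by fun_prop) fun t ht => ?_
    have : a ≤ t := ht
    have := hx.1
    intro h0
    linarith

/-- Monotone convergence as `t` decreases to `S`: the means along `S + 1/(n+1)` increase to the edge
mean, finite or not. -/
theorem IsBandLaw.exists_lt_integral [IsProbabilityMeasure P] (h : IsBandLaw P S)
    (hc : ENNReal.ofReal ρ < edgeMean P S) : ∃ t, S < t ∧ ρ < ∫ x, (x + t)⁻¹ ∂P := by
  let a : ℕ → ℝ := fun n => S + 1 / (n + 1)
  have ha (n : ℕ) : S < a n := by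
    have : (0 : ℝ) < 1 / (n + 1) := by positivity
    simp only [a]
    linarith
  have hae : ∀ᵐ x ∂P, ENNReal.ofReal ((x + S)⁻¹) ≤ ⨆ n, ENNReal.ofReal ((x + a n)⁻¹) := by
    filter_upwards [h.ae_pos le_rfl] with x hx
    refine le_of_tendsto' (x := Filter.atTop)
      (f := fun n => ENNReal.ofReal ((x + a n)⁻¹)) ?_ (fun n => le_iSup
        (fun n => ENNReal.ofReal ((x + a n)⁻¹)) n)
    refine (ENNReal.continuous_ofReal.tendsto _).comp (Filter.Tendsto.inv₀ ?_ hx.ne')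
    have := (tendsto_one_div_add_atTop_nhds_zero_nat (𝕜 := ℝ)).const_add S
    rw [add_zero] at this
    exact this.const_add x
  have hle : edgeMean P S ≤ ⨆ n, ∫⁻ x, ENNReal.ofReal ((x + a n)⁻¹) ∂P := by
    rw [h.edgeMean_eq]
    refine (lintegral_mono_ae hae).trans (le_of_eq ?_)
    refine lintegral_iSup_ae (fun n => by fun_prop) fun n => ?_
    filter_upwards [h.ae_pos (ha (n + 1)).le] with x hx
    refine ENNReal.ofReal_le_ofReal (inv_anti₀ hx ?_)
    simp only [a]
    gcongr
    simp
  obtain ⟨n, hn⟩ := lt_iSup_iff.1 (hc.trans_le hle)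
  refine ⟨a n, ha n, ?_⟩
  rw [← h.ofReal_integral (ha n).le (h.integrable_outside (ha n))] at hn
  exact lt_of_not_ge fun hge => absurd (ENNReal.ofReal_le_ofReal hge) (not_le.2 hn)

theorem IsBandLaw.exists_resolventMean [IsProbabilityMeasure P] (h : IsBandLaw P S) (hρ : 0 < ρ)
    (hc : ENNReal.ofReal ρ < edgeMean P S) : ∃ t, S < t ∧ ResolventMean P ρ t := by
  obtain ⟨a, ha, hlt⟩ := h.exists_lt_integral hc
  -- At distance at least `ρ⁻¹` from the band the kernel is at most `ρ`, which gives the other end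
  -- for the intermediate value theorem.
  let b : ℝ := max a (S + ρ⁻¹)
  have hab : a ≤ b := le_max_left _ _
  have hbρ : ∫ x, (x + b)⁻¹ ∂P ≤ ρ := by
    have hb : S < b := ha.trans_le hab
    have h1 : (b - S)⁻¹ ≤ ρ := by
      have : S + ρ⁻¹ ≤ b := le_max_right _ _
      rw [inv_le_comm₀ (by linarith) hρ]
      linarith
    have := norm_integral_le_of_norm_le_const (h.ae_norm_le hb)
    simp only [probReal_univ, mul_one] at this
    exact (le_abs_self _).trans (this.trans h1)
  have hcont : ContinuousOn (fun t => ∫ x, (x + t)⁻¹ ∂P) (Set.Icc a b) :=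
    (h.continuousOn_integral ha).mono Set.Icc_subset_Ici_self
  obtain ⟨t, ht, heq⟩ := intermediate_value_Icc' hab hcont ⟨hbρ, hlt.le⟩
  have hSt : S < t := ha.trans_le ht.1
  exact ⟨t, hSt, h.integrable_outside hSt, heq.symm⟩

end BandLaw

/-! ### Inverse moments from small-ball estimates -/

section Tails

variable {Ω : Type*} [MeasurableSpace Ω] {m : Measure Ω} {Y : Ω → ℝ}

theorem lintegral_Ioi_one_inv : ∫⁻ t in Set.Ioi (1 : ℝ), ENNReal.ofReal (t ^ (-1 : ℝ)) = ⊤ := by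
  by_contra hne
  have h : IntegrableOn (fun t : ℝ => t ^ (-1 : ℝ)) (Set.Ioi 1) := by
    refine (lintegral_ofReal_ne_top_iff_integrable ?_ ?_).1 hne
    · exact (by fun_prop : Measurable fun t : ℝ => t ^ (-1 : ℝ)).aestronglyMeasurable
    · filter_upwards [ae_restrict_mem measurableSet_Ioi] with t ht
      exact Real.rpow_nonneg (zero_le_one.trans (le_of_lt ht)) _
  rw [integrableOn_Ioi_rpow_iff one_pos] at h
  exact lt_irrefl _ h

/-- By the layer cake formula the moment is `p ∫ m{Y⁻¹ ≥ t} t^{p-1} dt`, and the tail bound makes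
the integrand at least `c / t` for `t > 1`. -/
theorem lintegral_inv_pow_eq_top (hY : Measurable Y) (hpos : ∀ᵐ x ∂m, 0 < Y x) {p : ℕ}
    (hp : p ≠ 0) {c : ℝ} (hc : 0 < c)
    (htail : ∀ ε, 0 < ε → ε ≤ 1 → ENNReal.ofReal (c * ε ^ p) ≤ m {x | Y x ≤ ε}) :
    ∫⁻ x, ENNReal.ofReal ((Y x)⁻¹ ^ p) ∂m = ⊤ := by
  have hp' : (0 : ℝ) < p := by positivity
  have key := lintegral_rpow_eq_lintegral_meas_le_mul m (f := fun x => (Y x)⁻¹)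
    (hpos.mono fun x hx => (inv_pos.2 hx).le) hY.inv.aemeasurable hp'
  simp only [Real.rpow_natCast] at key
  rw [key]
  refine ENNReal.mul_eq_top.2 (Or.inl ⟨by simpa using hp, ?_⟩)
  rw [eq_top_iff]
  calc (⊤ : ENNReal)
      = ENNReal.ofReal c * ∫⁻ t in Set.Ioi (1 : ℝ), ENNReal.ofReal (t ^ (-1 : ℝ)) := by
        rw [lintegral_Ioi_one_inv, ENNReal.mul_top (by simpa using hc)]
    _ = ∫⁻ t in Set.Ioi (1 : ℝ), ENNReal.ofReal c * ENNReal.ofReal (t ^ (-1 : ℝ)) := by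
        rw [lintegral_const_mul _ (by fun_prop)]
    _ ≤ ∫⁻ t in Set.Ioi (1 : ℝ), m {x | t ≤ (Y x)⁻¹} * ENNReal.ofReal (t ^ ((p : ℝ) - 1)) := by
        refine setLIntegral_mono_ae' measurableSet_Ioi (Filter.Eventually.of_forall fun t ht => ?_)
        have ht1 : 1 < t := ht
        have ht0 : 0 < t := one_pos.trans ht1
        have h1 : m {x | Y x ≤ t⁻¹} ≤ m {x | t ≤ (Y x)⁻¹} := by
          refine measure_mono_ae ?_
          filter_upwards [hpos] with x hx hle
          exact (le_inv_comm₀ ht0 hx).2 hle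
        have h2 := (htail t⁻¹ (inv_pos.2 ht0) (inv_le_one_of_one_le₀ ht1.le)).trans h1
        refine le_trans (le_of_eq ?_) (mul_le_mul_left h2 _)
        rw [← ENNReal.ofReal_mul hc.le, ← ENNReal.ofReal_mul (by positivity), mul_assoc,
          Real.rpow_sub_one ht0.ne', Real.rpow_natCast, Real.rpow_neg_one, inv_pow]
        congr 2
        field_simp
    _ ≤ _ := lintegral_mono_set (Set.Ioi_subset_Ioi zero_le_one)

/-- In the layer cake formula the tail `t^{-5/2}` times `t` is `t^{-3/2}`, integrable at infinity.
The exponent `5/2` comes from five phases, each confined to an interval of length of order `√ε`. -/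
theorem lintegral_inv_sq_lt_top [IsProbabilityMeasure m] (hY : Measurable Y)
    (hpos : ∀ᵐ x ∂m, 0 < Y x) {c : ℝ} (hc : 0 ≤ c)
    (htail : ∀ ε, 0 < ε → ε ≤ 1 → m {x | Y x ≤ ε} ≤ ENNReal.ofReal (c * ε ^ (5 / 2 : ℝ))) :
    ∫⁻ x, ENNReal.ofReal ((Y x)⁻¹ ^ 2) ∂m < ⊤ := by
  have key := lintegral_rpow_eq_lintegral_meas_le_mul m (f := fun x => (Y x)⁻¹)
    (hpos.mono fun x hx => (inv_pos.2 hx).le) hY.inv.aemeasurable two_pos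
  simp only [Real.rpow_two] at key
  rw [key]
  refine ENNReal.mul_lt_top ENNReal.ofReal_lt_top ?_
  rw [← Set.Ioc_union_Ioi_eq_Ioi (zero_le_one (α := ℝ))]
  refine (lintegral_union_le _ _ _).trans_lt (ENNReal.add_lt_top.2 ⟨?_, ?_⟩)
  · calc _ ≤ ∫⁻ t in Set.Ioc (0 : ℝ) 1, 1 := by
          refine setLIntegral_mono_ae' measurableSet_Ioc
            (Filter.Eventually.of_forall fun t ht => ?_)
          refine mul_le_one' prob_le_one ?_
          rw [ENNReal.ofReal_le_one]
          norm_num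
          exact ht.2
      _ < ⊤ := by simp
  · calc _ ≤ ∫⁻ t in Set.Ioi (1 : ℝ), ENNReal.ofReal (c * t ^ (-3 / 2 : ℝ)) := by
          refine setLIntegral_mono_ae' measurableSet_Ioi
            (Filter.Eventually.of_forall fun t ht => ?_)
          have ht1 : 1 < t := ht
          have ht0 : 0 < t := one_pos.trans ht1
          have h1 : m {x | t ≤ (Y x)⁻¹} ≤ m {x | Y x ≤ t⁻¹} := by
            refine measure_mono_ae ?_
            filter_upwards [hpos] with x hx hle
            exact (le_inv_comm₀ ht0 hx).1 hle
          have h2 := h1.trans (htail t⁻¹ (inv_pos.2 ht0) (inv_le_one_of_one_le₀ ht1.le))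
          refine (mul_le_mul_left h2 _).trans (le_of_eq ?_)
          rw [← ENNReal.ofReal_mul (by positivity), mul_assoc, Real.inv_rpow ht0.le,
            ← Real.rpow_neg ht0.le, ← Real.rpow_add ht0]
          norm_num
      _ < ⊤ := by
          refine Integrable.lintegral_lt_top (Integrable.const_mul ?_ c)
          exact (integrableOn_Ioi_rpow_iff one_pos).2 (by norm_num)

end Tails

/-! ### Uniform phases on the circle and the torus -/

section Phases

open Real

/-- The uniform probability measure on `(-π, π]`. -/
def circleLaw : Measure ℝ := (ENNReal.ofReal (2 * π))⁻¹ • volume.restrict (Set.Ioc (-π) π)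

instance : IsProbabilityMeasure circleLaw where
  measure_univ := by
    have : π - -π = 2 * π := by ring
    simp only [circleLaw, Measure.smul_apply, Measure.restrict_apply_univ, volume_Ioc, this,
      smul_eq_mul]
    exact ENNReal.inv_mul_cancel (by simpa using pi_pos) ENNReal.ofReal_ne_top

/-- The uniform probability measure on the torus. -/
def phaseLaw (d : ℕ) : Measure (Fin d → ℝ) := Measure.pi fun _ => circleLaw

instance (d : ℕ) : IsProbabilityMeasure (phaseLaw d) := by
  unfold phaseLaw
  infer_instance

theorem phaseLaw_eq (d : ℕ) :
    phaseLaw d = (ENNReal.ofReal ((2 * π) ^ d))⁻¹ • volume.restrict (torus d) := by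
  refine Measure.pi_eq fun A hA => ?_
  have h1 : volume.restrict (torus d) (Set.univ.pi A)
      = ∏ i, volume.restrict (Set.Ioc (-π) π) (A i) := by
    rw [torus, volume_pi, Measure.restrict_pi_pi, Measure.pi_pi]
  rw [Measure.smul_apply, h1]
  simp only [circleLaw, Measure.smul_apply, smul_eq_mul, Finset.prod_mul_distrib,
    Finset.prod_const, Finset.card_univ, Fintype.card_fin]
  rw [ENNReal.ofReal_pow (by positivity), ENNReal.inv_pow]

theorem phaseLaw_pi {d : ℕ} (A : Fin d → Set ℝ) :
    phaseLaw d (Set.univ.pi A) = ∏ k, circleLaw (A k) := Measure.pi_pi _ _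

theorem circleLaw_Icc {a b : ℝ} (ha : -π < a) (hb : b ≤ π) :
    circleLaw (Set.Icc a b) = ENNReal.ofReal ((b - a) / (2 * π)) := by
  have h : Set.Icc a b ∩ Set.Ioc (-π) π = Set.Icc a b :=
    Set.inter_eq_left.2 fun x hx => ⟨ha.trans_le hx.1, hx.2.trans hb⟩
  rw [circleLaw, Measure.smul_apply, Measure.restrict_apply measurableSet_Icc, h, volume_Icc,
    smul_eq_mul, ← ENNReal.ofReal_inv_of_pos (by positivity), ← ENNReal.ofReal_mul (by positivity)]
  congr 1
  field_simp

theorem circleLaw_Icc_le {a b : ℝ} :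
    circleLaw (Set.Icc a b) ≤ ENNReal.ofReal ((b - a) / (2 * π)) := by
  rw [circleLaw, Measure.smul_apply, smul_eq_mul]
  refine (mul_le_mul_right (Measure.restrict_apply_le _ _) _).trans (le_of_eq ?_)
  rw [volume_Icc, ← ENNReal.ofReal_inv_of_pos (by positivity),
    ← ENNReal.ofReal_mul (by positivity)]
  congr 1
  field_simp

theorem circleLaw_cos_eq (b : ℝ) : circleLaw {ψ | cos ψ = b} = 0 := by
  rw [circleLaw, Measure.smul_apply, Measure.restrict_apply (measurableSet_eq_fun (by fun_prop)
    (by fun_prop)), smul_eq_mul]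
  refine mul_eq_zero_of_right _ ?_
  refine measure_mono_null (t := {arccos b, -arccos b}) ?_ (Set.Finite.measure_zero (by simp) _)
  rintro ψ ⟨rfl, h1, h2⟩
  rcases le_total 0 ψ with h0 | h0
  · left
    exact (arccos_cos h0 h2).symm
  · right
    have := arccos_cos (x := -ψ) (by linarith) (by linarith)
    rw [cos_neg] at this
    rw [Set.mem_singleton_iff, this, neg_neg]

/-- Cosine is 1-Lipschitz, so an interval of length of order `ε` at a solution of `r cos α = a`
works. The constant does not depend on `a`, as is needed when `a` is later the contribution of the
other phases. -/
theorem circleLaw_cos_near {r : ℝ} (hr : 0 < r) : ∃ c > 0, ∀ a, |a| ≤ r → ∀ ε, 0 < ε → ε ≤ 1 →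
    ENNReal.ofReal (c * ε) ≤ circleLaw {ψ | |r * cos ψ - a| ≤ ε} := by
  refine ⟨(r + 1)⁻¹ / (2 * π), by positivity, fun a ha ε hε hε1 => ?_⟩
  set δ := (r + 1)⁻¹ * ε with hδ
  have hδ0 : 0 < δ := by positivity
  have hδ1 : δ ≤ 1 := mul_le_one₀ (inv_le_one_of_one_le₀ (by linarith)) hε.le hε1
  have hrδ : r * δ ≤ ε := by
    rw [hδ, ← mul_assoc]
    refine mul_le_of_le_one_left hε.le ?_
    rw [← div_eq_mul_inv, div_le_one (by linarith)]
    linarith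
  have hpi := pi_gt_three
  set α := arccos (a / r)
  have hα0 : 0 ≤ α := arccos_nonneg _
  have hαπ : α ≤ π := arccos_le_pi _
  have habs := abs_le.1 ha
  have hcos : r * cos α = a := by
    rw [cos_arccos (by rw [le_div_iff₀ hr]; linarith) (by rw [div_le_one hr]; linarith)]
    field_simp
  have key (x y : ℝ) (hx : 0 ≤ x) (hy : y ≤ π) (hxy : y - x = δ) (hmem : α ∈ Set.Icc x y) :
      ENNReal.ofReal ((r + 1)⁻¹ / (2 * π) * ε) ≤ circleLaw {ψ | |r * cos ψ - a| ≤ ε} := by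
    have hsub : Set.Icc x y ⊆ {ψ | |r * cos ψ - a| ≤ ε} := by
      intro ψ hψ
      have h1 : |cos ψ - cos α| ≤ |ψ - α| := abs_cos_sub_cos_le ψ α
      have h2 : |ψ - α| ≤ δ := abs_le.2 ⟨by linarith [hψ.1, hmem.2], by linarith [hψ.2, hmem.1]⟩
      rw [Set.mem_ofPred_eq, ← hcos, ← mul_sub, abs_mul, abs_of_pos hr]
      exact (mul_le_mul_of_nonneg_left (h1.trans h2) hr.le).trans hrδ
    refine le_trans (le_of_eq ?_) (measure_mono hsub)
    rw [circleLaw_Icc (by linarith) hy, hxy, hδ]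
    congr 1
    ring
  -- The interval is laid on the side of `α` that stays within `[0, π]`; this uses `δ ≤ 1` and `π >
  -- 3`.
  rcases le_total α 1 with h | h
  · exact key α (α + δ) hα0 (by linarith) (by ring) ⟨le_rfl, by linarith⟩
  · exact key (α - δ) α (by linarith) hαπ (by ring) ⟨by linarith, le_rfl⟩

end Phases

/-! ### The law of a sum of cosines -/

section CosSum

open Real

variable {d : ℕ}

/-- `ψ ↦ ∑ a_k cos ψ_k`. -/
def cosSum (a ψ : Fin d → ℝ) : ℝ := ∑ k, a k * cos (ψ k)

theorem continuous_cosSum (a : Fin d → ℝ) : Continuous (cosSum a) := by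
  unfold cosSum
  fun_prop

theorem measurable_cosSum (a : Fin d → ℝ) : Measurable (cosSum a) :=
  (continuous_cosSum a).measurable

/-- The distribution of `∑ a_k cos ψ_k` for independent uniform phases `ψ_k`. -/
def bandLaw (a : Fin d → ℝ) : Measure ℝ := (phaseLaw d).map (cosSum a)

instance (a : Fin d → ℝ) : IsProbabilityMeasure (bandLaw a) :=
  Measure.isProbabilityMeasure_map (measurable_cosSum a).aemeasurable

theorem bandLaw_apply (a : Fin d → ℝ) {A : Set ℝ} (hA : MeasurableSet A) :
    bandLaw a A = phaseLaw d (cosSum a ⁻¹' A) :=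
  Measure.map_apply (measurable_cosSum a) hA

/-- The Haar probability measure on `(ℝ/ℤ)^d`. -/
abbrev haarTorus (d : ℕ) : Measure (UnitAddTorus (Fin d)) :=
  Measure.pi fun _ => AddCircle.haarAddCircle

theorem measurePreserving_angle (θ : ℝ) :
    MeasurePreserving (fun ψ : ℝ => (((ψ - θ) / (2 * π) : ℝ) : UnitAddCircle)) circleLaw
      AddCircle.haarAddCircle := by
  have h1 : MeasurePreserving (fun ψ : ℝ => (2 * π)⁻¹ * ψ) circleLaw
      (volume.restrict (Set.Ioc (-(1 / 2)) (-(1 / 2) + 1))) := by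
    have hpi := pi_pos
    refine ⟨by fun_prop, Measure.ext fun A hA => ?_⟩
    rw [Measure.map_apply (by fun_prop) hA, circleLaw, Measure.smul_apply,
      Measure.restrict_apply (by measurability), Measure.restrict_apply hA, smul_eq_mul]
    have hset : (fun ψ : ℝ => (2 * π)⁻¹ * ψ) ⁻¹' A ∩ Set.Ioc (-π) π
        = (fun ψ : ℝ => (2 * π)⁻¹ * ψ) ⁻¹' (A ∩ Set.Ioc (-(1 / 2)) (-(1 / 2) + 1)) := by
      ext ψ
      simp only [Set.mem_inter_iff, Set.mem_preimage, Set.mem_Ioc]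
      refine and_congr_right fun _ => and_congr ?_ ?_
      · rw [inv_mul_eq_div, lt_div_iff₀ (by positivity)]
        constructor <;> intro h <;> linarith
      · rw [inv_mul_eq_div, div_le_iff₀ (by positivity)]
        constructor <;> intro h <;> linarith
    rw [hset, Real.volume_preimage_mul_left (by positivity), inv_inv, abs_of_pos (by positivity),
      ← mul_assoc, ENNReal.inv_mul_cancel (by simpa using hpi) ENNReal.ofReal_ne_top, one_mul]
  have h2 : MeasurePreserving ((↑) : ℝ → UnitAddCircle)
      (volume.restrict (Set.Ioc (-(1 / 2) : ℝ) (-(1 / 2) + 1))) AddCircle.haarAddCircle := by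
    have := UnitAddCircle.measurePreserving_mk (-(1 / 2))
    rwa [AddCircle.volume_eq_smul_haarAddCircle, ENNReal.ofReal_one, one_smul] at this
  have h3 := (measurePreserving_add_right (AddCircle.haarAddCircle (T := 1))
    (((-θ / (2 * π) : ℝ) : UnitAddCircle))).comp (h2.comp h1)
  convert h3 using 1
  funext ψ
  simp only [Function.comp_apply]
  rw [← AddCircle.coe_add]
  congr 1
  ring

theorem fourier_one_coe_angle (α : ℝ) :
    fourier 1 ((α / (2 * π) : ℝ) : UnitAddCircle) = Complex.exp (Complex.I * α) := by
  rw [fourier_coe_apply]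
  congr 1
  push_cast
  have : (π : ℂ) ≠ 0 := by exact_mod_cast pi_ne_zero
  field_simp

/-- The trigonometric polynomial `∑ Re (w_k e^{2πi x_k})` on `(ℝ/ℤ)^d`. -/
def trigSum (w : Fin d → ℂ) (x : UnitAddTorus (Fin d)) : ℝ :=
  ∑ k, (w k * fourier 1 (x k)).re

theorem continuous_trigSum (w : Fin d → ℂ) : Continuous (trigSum w) := by
  unfold trigSum
  fun_prop

theorem trigSum_angle (w : Fin d → ℂ) (ψ : Fin d → ℝ) :
    trigSum w (fun k => (((ψ k - (w k).arg) / (2 * π) : ℝ) : UnitAddCircle))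
      = cosSum (fun k => ‖w k‖) ψ := by
  unfold trigSum cosSum
  refine Finset.sum_congr rfl fun k _ => ?_
  rw [fourier_one_coe_angle]
  conv_lhs => rw [← Complex.norm_mul_exp_arg_mul_I (w k)]
  rw [mul_assoc, ← Complex.exp_add, ← Complex.exp_ofReal_mul_I_re, Complex.re_ofReal_mul]
  congr 3
  push_cast
  simp
  ring

/-- Rotating each coordinate by the argument of `w_k` preserves Haar measure, so the law depends
only on the moduli. This removes the arguments of the hopping amplitudes and also yields the
symmetry of the law. -/
theorem measurePreserving_trigSum (w : Fin d → ℂ) :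
    MeasurePreserving (trigSum w) (haarTorus d) (bandLaw fun k => ‖w k‖) := by
  have h := measurePreserving_pi (fun _ : Fin d => circleLaw)
    (fun _ : Fin d => AddCircle.haarAddCircle (T := 1))
    (fun k => measurePreserving_angle (w k).arg)
  refine ⟨(continuous_trigSum w).measurable, ?_⟩
  rw [haarTorus, ← h.map_eq, Measure.map_map (continuous_trigSum w).measurable h.measurable]
  unfold bandLaw phaseLaw
  congr 1
  funext ψ
  exact trigSum_angle w ψ

theorem bandLaw_symm {a : Fin d → ℝ} (ha : ∀ k, 0 ≤ a k) :
    MeasurePreserving (fun x : ℝ => -x) (bandLaw a) (bandLaw a) := by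
  have h1 := measurePreserving_trigSum fun k => (a k : ℂ)
  -- Changing the sign of every coefficient negates the sum but keeps the moduli.
  have h2 := measurePreserving_trigSum fun k => -(a k : ℂ)
  simp only [norm_neg, Complex.norm_real, norm_of_nonneg (ha _)] at h1 h2
  refine ⟨measurable_neg, ?_⟩
  conv_lhs => rw [← h1.map_eq, Measure.map_map measurable_neg h1.measurable]
  rw [← h2.map_eq]
  congr 1
  funext x
  simp [trigSum]

theorem abs_cosSum_le {a : Fin d → ℝ} (ha : ∀ k, 0 ≤ a k) (ψ : Fin d → ℝ) :
    |cosSum a ψ| ≤ ∑ k, a k := by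
  refine (Finset.abs_sum_le_sum_abs _ _).trans (Finset.sum_le_sum fun k _ => ?_)
  rw [abs_mul, abs_of_nonneg (ha k)]
  exact mul_le_of_le_one_right (ha k) (abs_cos_le_one _)

theorem bandLaw_ae_mem {a : Fin d → ℝ} (ha : ∀ k, 0 ≤ a k) :
    ∀ᵐ x ∂bandLaw a, x ∈ Set.Icc (-∑ k, a k) (∑ k, a k) := by
  unfold bandLaw
  refine (ae_map_iff (measurable_cosSum a).aemeasurable measurableSet_Icc).2 ?_
  exact Filter.Eventually.of_forall fun ψ => abs_le.1 (abs_cosSum_le ha ψ)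

theorem phaseLaw_pos_of_isOpen {U : Set (Fin d → ℝ)} (hU : IsOpen U) {ψ : Fin d → ℝ}
    (hψ : ψ ∈ U) (hψπ : ∀ k, ψ k ∈ Set.Ioo (-π) π) : 0 < phaseLaw d U := by
  have hbox : IsOpen (U ∩ Set.univ.pi fun _ : Fin d => Set.Ioo (-π) π) :=
    hU.inter (isOpen_set_pi Set.finite_univ fun _ _ => isOpen_Ioo)
  have hpos : 0 < volume (U ∩ Set.univ.pi fun _ : Fin d => Set.Ioo (-π) π) :=
    hbox.measure_pos volume ⟨ψ, hψ, fun k _ => hψπ k⟩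
  rw [phaseLaw_eq, Measure.smul_apply, Measure.restrict_apply hU.measurableSet, smul_eq_mul]
  refine ENNReal.mul_pos (by simp) (hpos.trans_le (measure_mono ?_)).ne'
  exact Set.inter_subset_inter_right _ (Set.pi_mono fun _ _ => Set.Ioo_subset_Ioc_self)

/-- Fubini in the coordinate `k`. -/
theorem phaseLaw_preimage_cosSum {n : ℕ} (a : Fin (n + 1) → ℝ) (k : Fin (n + 1)) {A : Set ℝ}
    (hA : MeasurableSet A) :
    phaseLaw (n + 1) (cosSum a ⁻¹' A) = ∫⁻ y, circleLaw {x | a k * cos x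
      + cosSum (fun j => a (k.succAbove j)) y ∈ A} ∂phaseLaw n := by
  have hmp := measurePreserving_piFinSuccAbove (fun _ : Fin (n + 1) => circleLaw) k
  have hm : MeasurableSet {p : ℝ × (Fin n → ℝ) | a k * cos p.1
      + cosSum (fun j => a (k.succAbove j)) p.2 ∈ A} :=
    (((measurable_cos.comp measurable_fst).const_mul _).add
      ((measurable_cosSum _).comp measurable_snd)) hA
  have h := hmp.measure_preimage hm.nullMeasurableSet
  rw [Measure.prod_apply_symm hm] at h
  rw [phaseLaw, phaseLaw]
  refine Eq.trans (congrArg _ ?_) h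
  ext ψ
  simp only [Set.mem_preimage, Set.mem_ofPred_eq, cosSum, Fin.sum_univ_succAbove _ k]
  rfl

/-- Once the other phases are fixed, a single phase with nonzero coefficient already has no atoms.
-/
theorem bandLaw_noAtom {a : Fin d → ℝ} {k : Fin d} (hk : a k ≠ 0) (b : ℝ) :
    bandLaw a {b} = 0 := by
  obtain ⟨n, rfl⟩ : ∃ n, d = n + 1 := ⟨d - 1, by have := k.2; omega⟩
  rw [bandLaw_apply a (measurableSet_singleton b),
    phaseLaw_preimage_cosSum a k (measurableSet_singleton b)]
  refine lintegral_eq_zero_of_ae_eq_zero (Filter.Eventually.of_forall fun y => ?_)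
  refine measure_mono_null ?_ (circleLaw_cos_eq
    ((b - cosSum (fun j => a (k.succAbove j)) y) / a k))
  intro x hx
  rw [Set.mem_ofPred_eq, eq_div_iff hk, mul_comm]
  exact eq_sub_of_add_eq hx

/-- For an open set `B` of values of the other phases, of positive measure, the remaining target is
within reach of `a_k cos`. The uniform estimate `circleLaw_cos_near` is then integrated over `B`. -/
theorem bandLaw_near_interior {a : Fin d → ℝ} (ha : ∀ k, 0 ≤ a k) {k : Fin d} (hk : 0 < a k)
    {t : ℝ} (ht : |t| < ∑ k, a k) : ∃ c > 0, ∀ ε, 0 < ε → ε ≤ 1 →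
      ENNReal.ofReal (c * ε) ≤ bandLaw a {x | |x + t| ≤ ε} := by
  obtain ⟨n, rfl⟩ : ∃ n, d = n + 1 := ⟨d - 1, by have := k.2; omega⟩
  obtain ⟨c, hc, hnear⟩ := circleLaw_cos_near hk
  set b : Fin n → ℝ := fun j => a (k.succAbove j) with hb
  set S := ∑ k, a k with hS
  have hS0 : 0 < S := (abs_nonneg t).trans_lt ht
  have hSb : S = a k + ∑ j, b j := Fin.sum_univ_succAbove _ k
  let B : Set (Fin n → ℝ) := {y | |t + cosSum b y| < a k}
  have hBo : IsOpen B := isOpen_lt (by have := continuous_cosSum b; fun_prop) continuous_const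
  have habs := abs_lt.1 ht
  have hv1 : -1 < -t / S := by rw [lt_div_iff₀ hS0]; linarith
  have hv2 : -t / S < 1 := by rw [div_lt_one hS0]; linarith
  have hBpos : 0 < phaseLaw n B := by
    -- With every phase equal to `arccos (-t / S)` the full sum would be exactly `-t`; omitting the
    -- `k`-th term leaves `(t / S) a_k`, of modulus less than `a_k`.
    refine phaseLaw_pos_of_isOpen hBo (ψ := fun _ => arccos (-t / S)) ?_ fun j => ⟨?_, ?_⟩
    · have h1 : cosSum b (fun _ => arccos (-t / S)) = (∑ j, b j) * (-t / S) := by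
        rw [cosSum, ← Finset.sum_mul, cos_arccos hv1.le hv2.le]
      have h2 : t + (∑ j, b j) * (-t / S) = t / S * a k := by
        have : ∑ j, b j = S - a k := by rw [hSb]; ring
        rw [this]
        field_simp
        ring
      simp only [B, Set.mem_ofPred_eq, h1, h2]
      rw [abs_mul, abs_of_pos hk, abs_div, abs_of_pos hS0]
      exact mul_lt_of_lt_one_left hk ((div_lt_one hS0).2 ht)
    · exact (neg_neg_of_pos pi_pos).trans_le (arccos_nonneg _)
    · refine lt_of_le_of_ne (arccos_le_pi _) fun h => ?_
      rw [arccos_eq_pi] at h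
      linarith
  refine ⟨c * (phaseLaw n B).toReal, mul_pos hc (ENNReal.toReal_pos hBpos.ne'
    (measure_ne_top _ _)), fun ε hε hε1 => ?_⟩
  have hA : MeasurableSet {x : ℝ | |x + t| ≤ ε} := measurableSet_le (by fun_prop) (by fun_prop)
  rw [bandLaw_apply a hA, phaseLaw_preimage_cosSum a k hA]
  calc ENNReal.ofReal (c * (phaseLaw n B).toReal * ε)
      = ∫⁻ _ in B, ENNReal.ofReal (c * ε) ∂phaseLaw n := by
        rw [setLIntegral_const, mul_right_comm, ENNReal.ofReal_mul (by positivity),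
          ENNReal.ofReal_toReal (measure_ne_top _ _)]
    _ ≤ ∫⁻ y in B, circleLaw {x | a k * cos x + cosSum b y ∈ {x : ℝ | |x + t| ≤ ε}}
          ∂phaseLaw n := by
        refine setLIntegral_mono_ae' hBo.measurableSet (Filter.Eventually.of_forall
          fun y hy => ?_)
        refine (hnear (-(t + cosSum b y)) (by rw [abs_neg]; exact le_of_lt hy) ε hε hε1).trans
          (le_of_eq ?_)
        congr 1
        ext x
        simp only [Set.mem_ofPred_eq]
        rw [show a k * cos x - -(t + cosSum b y) = a k * cos x + cosSum b y + t by ring]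
    _ ≤ _ := setLIntegral_le_lintegral _ _

theorem not_integrable_of_tail {P : Measure ℝ} {t : ℝ} (hne : P {-t} = 0) {c : ℝ} (hc : 0 < c)
    (htail : ∀ ε, 0 < ε → ε ≤ 1 → ENNReal.ofReal (c * ε) ≤ P {x | |x + t| ≤ ε}) :
    ¬ Integrable (fun x => (x + t)⁻¹) P := by
  intro hi
  have hpos : ∀ᵐ x ∂P, 0 < |x + t| := by
    have : ∀ᵐ x ∂P, x ≠ -t := by rw [ae_iff]; simpa using hne
    filter_upwards [this] with x hx
    exact abs_pos.2 fun h => hx (by linarith)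
  have h1 := lintegral_inv_pow_eq_top (m := P) (Y := fun x => |x + t|) (by fun_prop) hpos
    one_ne_zero hc (by simpa using htail)
  have h2 := hi.abs.lintegral_lt_top
  simp only [pow_one, abs_inv] at h1 h2
  exact h2.ne h1

theorem isBandLaw_bandLaw {a : Fin d → ℝ} (ha : ∀ k, 0 ≤ a k) {k : Fin d} (hk : a k ≠ 0) :
    IsBandLaw (bandLaw a) (∑ k, a k) where
  ae_mem := bandLaw_ae_mem ha
  symm := bandLaw_symm ha
  noAtom := bandLaw_noAtom hk
  not_integrable t ht := by
    obtain ⟨c, hc, h⟩ := bandLaw_near_interior ha (lt_of_le_of_ne (ha k) hk.symm) ht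
    exact not_integrable_of_tail (bandLaw_noAtom hk _) hc h

end CosSum

/-! ### Mass of the law near the band edge -/

section Edge

open Real

variable {d : ℕ} {a : Fin d → ℝ}

/-- The number of nonzero entries. -/
def numNonzero (a : Fin d → ℝ) : ℕ := (Finset.univ.filter fun k => a k ≠ 0).card

/-- The box `|ψ_k| ≤ δ` in the coordinates with `a_k ≠ 0`. -/
def activeBox (a : Fin d → ℝ) (δ : ℝ) : Set (Fin d → ℝ) :=
  Set.univ.pi fun k => if a k = 0 then Set.univ else Set.Icc (-δ) δ

theorem phaseLaw_activeBox (a : Fin d → ℝ) (δ : ℝ) :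
    phaseLaw d (activeBox a δ) = circleLaw (Set.Icc (-δ) δ) ^ numNonzero a := by
  rw [activeBox, phaseLaw_pi, numNonzero, ← Finset.prod_const, Finset.prod_filter]
  refine Finset.prod_congr rfl fun k _ => ?_
  by_cases hk : a k = 0
  · simp [hk]
  · simp [hk]

theorem sum_sub_cosSum (a ψ : Fin d → ℝ) :
    ∑ k, a k - cosSum a ψ = ∑ k, a k * (1 - cos (ψ k)) := by
  rw [cosSum, ← Finset.sum_sub_distrib]
  exact Finset.sum_congr rfl fun k _ => by ring

theorem bandLaw_edge_eq (ha : ∀ k, 0 ≤ a k) (ε : ℝ) :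
    bandLaw a {x | |x + ∑ k, a k| ≤ ε} =
      phaseLaw d {ψ | ∑ k, a k * (1 - cos (ψ k)) ≤ ε} := by
  have hA : MeasurableSet {x : ℝ | |x + ∑ k, a k| ≤ ε} :=
    measurableSet_le (by fun_prop) (by fun_prop)
  rw [← (bandLaw_symm ha).measure_preimage hA.nullMeasurableSet,
    bandLaw_apply a (measurable_neg hA)]
  congr 1
  ext ψ
  simp only [Set.mem_preimage, Set.mem_ofPred_eq]
  rw [neg_add_eq_sub, sum_sub_cosSum, abs_of_nonneg]
  exact Finset.sum_nonneg fun k _ => mul_nonneg (ha k) (by linarith [cos_le_one (ψ k)])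

/-- Since `1 - cos ψ ≤ ψ²/2`, a box of side of order `√ε` in the `n` active phases lies in the
event; its mass is of order `ε^{n/2}`. -/
theorem bandLaw_edge_lower (ha : ∀ k, 0 ≤ a k) {p : ℕ} (hp : numNonzero a ≤ 2 * p) :
    ∃ c > 0, ∀ ε, 0 < ε → ε ≤ 1 →
      ENNReal.ofReal (c * ε ^ p) ≤ bandLaw a {x | |x + ∑ k, a k| ≤ ε} := by
  set S := ∑ k, a k with hS
  have hS0 : 0 ≤ S := Finset.sum_nonneg fun k _ => ha k
  have hpi := pi_gt_three
  -- The half-side is `δ` with `δ² = 2ε / (S + 2)`, which secures both `S δ² / 2 ≤ ε` and `δ ≤ 1`.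
  -- Each active phase contributes `δ / π`, and `(δ / π)^{2p}` is this constant times `ε^p`.
  refine ⟨(2 / (S + 2) / π ^ 2) ^ p, by positivity, fun ε hε hε1 => ?_⟩
  rw [hS, bandLaw_edge_eq ha, ← hS]
  set δ := √(2 / (S + 2) * ε) with hδ
  have hδsq : δ ^ 2 = 2 / (S + 2) * ε := sq_sqrt (by positivity)
  have hκ : 2 / (S + 2) ≤ 1 := by
    rw [div_le_one (by linarith)]
    linarith
  have hδ0 : 0 ≤ δ := sqrt_nonneg _
  have hδ1 : δ ≤ 1 := by
    rw [← abs_of_nonneg hδ0, ← sq_le_one_iff_abs_le_one, hδsq]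
    exact mul_le_one₀ hκ hε.le hε1
  have hsub : activeBox a δ ⊆ {ψ | ∑ k, a k * (1 - cos (ψ k)) ≤ ε} := by
    intro ψ hψ
    calc ∑ k, a k * (1 - cos (ψ k)) ≤ ∑ k, a k * (δ ^ 2 / 2) := by
          refine Finset.sum_le_sum fun k _ => ?_
          by_cases hk : a k = 0
          · simp [hk]
          · have hm := hψ k (Set.mem_univ k)
            simp only [hk, if_false] at hm
            have h1 : ψ k ^ 2 ≤ δ ^ 2 := sq_le_sq' hm.1 hm.2
            have h2 := one_sub_sq_div_two_le_cos (x := ψ k)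
            exact mul_le_mul_of_nonneg_left (by linarith) (ha k)
      _ = S / (S + 2) * ε := by
          rw [← Finset.sum_mul, ← hS, hδsq]
          ring
      _ ≤ ε := mul_le_of_le_one_left hε.le (by rw [div_le_one (by linarith)]; linarith)
  refine le_trans ?_ (measure_mono hsub)
  rw [phaseLaw_activeBox, circleLaw_Icc (by linarith) (by linarith)]
  have heq : (δ - -δ) / (2 * π) = δ / π := by
    field_simp
    ring
  rw [heq, ← ENNReal.ofReal_pow (by positivity)]
  refine ENNReal.ofReal_le_ofReal ?_
  calc (2 / (S + 2) / π ^ 2) ^ p * ε ^ p = (δ / π) ^ (2 * p) := by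
        rw [← mul_pow, pow_mul, div_pow, hδsq]
        congr 1
        ring
    _ ≤ (δ / π) ^ numNonzero a :=
        pow_le_pow_of_le_one (by positivity) (by rw [div_le_one pi_pos]; linarith) hp

/-- On the torus `1 - cos ψ ≥ 2ψ²/π²`, so the event confines each active phase to an interval of
length of order `√ε`, uniformly because the nonzero coefficients have a positive minimum `m`. -/
theorem bandLaw_edge_upper (ha : ∀ k, 0 ≤ a k) (h5 : 5 ≤ numNonzero a) :
    ∃ c ≥ 0, ∀ ε, 0 < ε → ε ≤ 1 →
      bandLaw a {x | |x + ∑ k, a k| ≤ ε} ≤ ENNReal.ofReal (c * ε ^ (5 / 2 : ℝ)) := by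
  obtain ⟨m, hm0, hm⟩ : ∃ m > 0, ∀ k, a k ≠ 0 → m ≤ a k := by
    have hne : (Finset.univ.filter fun k => a k ≠ 0).Nonempty := by
      rw [← Finset.card_pos]
      unfold numNonzero at h5
      omega
    obtain ⟨k, hk, hmin⟩ := Finset.exists_min_image _ a hne
    refine ⟨a k, lt_of_le_of_ne (ha k) (Finset.mem_filter.1 hk).2.symm, fun j hj => ?_⟩
    exact hmin j (by simpa using hj)
  refine ⟨√(1 / (2 * m)) ^ numNonzero a, by positivity, fun ε hε hε1 => ?_⟩
  rw [bandLaw_edge_eq ha]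
  set δ := π * √(ε / (2 * m)) with hδ
  have hsub : phaseLaw d {ψ | ∑ k, a k * (1 - cos (ψ k)) ≤ ε} ≤ phaseLaw d (activeBox a δ) := by
    refine measure_mono_ae ?_
    have htor : ∀ᵐ ψ ∂phaseLaw d, ψ ∈ torus d := by
      rw [phaseLaw_eq]
      refine Measure.ae_smul_measure (ae_restrict_mem ?_) _
      exact MeasurableSet.univ_pi fun _ => measurableSet_Ioc
    filter_upwards [htor] with ψ hψt hψ k _
    by_cases hk : a k = 0
    · simp [hk]
    · simp only [hk, if_false]
      have hnn (j : Fin d) : 0 ≤ a j * (1 - cos (ψ j)) :=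
        mul_nonneg (ha j) (by linarith [cos_le_one (ψ j)])
      have h1 : a k * (1 - cos (ψ k)) ≤ ε :=
        (Finset.single_le_sum (f := fun j => a j * (1 - cos (ψ j))) (fun j _ => hnn j)
          (Finset.mem_univ k)).trans hψ
      have hψk := hψt k (Set.mem_univ k)
      have h2 := cos_le_one_sub_mul_cos_sq (x := ψ k) (abs_le.2 ⟨hψk.1.le, hψk.2⟩)
      have h3 : m * (2 / π ^ 2 * ψ k ^ 2) ≤ ε := by
        refine le_trans ?_ h1
        exact mul_le_mul (hm k hk) (by linarith) (by positivity) (ha k)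
      have h4 : ψ k ^ 2 ≤ δ ^ 2 := by
        rw [hδ, mul_pow, sq_sqrt (by positivity), ← mul_div_assoc, le_div_iff₀ (by positivity)]
        have : m * (2 / π ^ 2 * ψ k ^ 2) = ψ k ^ 2 * (2 * m) / π ^ 2 := by ring
        rw [this, div_le_iff₀ (by positivity)] at h3
        linarith
      exact abs_le.1 (abs_le_of_sq_le_sq h4 (by positivity))
  refine hsub.trans ?_
  rw [phaseLaw_activeBox]
  refine (pow_le_pow_left' circleLaw_Icc_le _).trans ?_
  have heq : (δ - -δ) / (2 * π) = √(1 / (2 * m)) * √ε := by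
    rw [← sqrt_mul (by positivity), one_div_mul_eq_div, hδ]
    field_simp
    ring
  rw [heq, ← ENNReal.ofReal_pow (by positivity)]
  refine ENNReal.ofReal_le_ofReal ?_
  rw [mul_pow]
  refine mul_le_mul_of_nonneg_left ?_ (by positivity)
  calc √ε ^ numNonzero a ≤ √ε ^ 5 :=
        pow_le_pow_of_le_one (sqrt_nonneg _) (sqrt_le_one.2 hε1) h5
    _ = ε ^ (5 / 2 : ℝ) := by
        rw [sqrt_eq_rpow, ← rpow_natCast, ← rpow_mul hε.le]
        norm_num

theorem edge_ae_pos {P : Measure ℝ} {S : ℝ} (h : IsBandLaw P S) : ∀ᵐ x ∂P, 0 < |x + S| :=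
  (h.ae_pos le_rfl).mono fun _ hx => abs_pos.2 hx.ne'

theorem edgeMean_eq_top (ha : ∀ k, 0 ≤ a k) {k : Fin d} (hk : a k ≠ 0)
    (h2 : numNonzero a ≤ 2) : edgeMean (bandLaw a) (∑ k, a k) = ⊤ := by
  by_contra hne
  have h := isBandLaw_bandLaw ha hk
  obtain ⟨c, hc, ht⟩ := bandLaw_edge_lower ha (p := 1) (by omega)
  exact not_integrable_of_tail (h.noAtom _) hc (by simpa using ht) (h.integrable_edge_iff.2 hne)

/-- The threshold compares the mass exponent `n/2` with the exponent `2` of the squared kernel: four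
active phases still give divergence, five give convergence. -/
theorem memLp_edge_iff (ha : ∀ k, 0 ≤ a k) {k : Fin d} (hk : a k ≠ 0) :
    MemLp (fun x => (x + ∑ k, a k)⁻¹) 2 (bandLaw a) ↔ 5 ≤ numNonzero a := by
  have h := isBandLaw_bandLaw ha hk
  rw [memLp_two_iff_integrable_sq (kernel_measurable _).aestronglyMeasurable,
    ← lintegral_ofReal_ne_top_iff_integrable
      ((kernel_measurable _).pow_const 2).aestronglyMeasurable
      (Filter.Eventually.of_forall fun x => sq_nonneg _)]
  have heq (x : ℝ) : (x + ∑ k, a k)⁻¹ ^ 2 = |x + ∑ k, a k|⁻¹ ^ 2 := by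
    rw [← abs_inv, sq_abs]
  simp only [heq]
  constructor
  · intro hne
    by_contra! hlt
    obtain ⟨c, hc, ht⟩ := bandLaw_edge_lower ha (p := 2) (by omega)
    exact hne (lintegral_inv_pow_eq_top (Y := fun x => |x + ∑ k, a k|) (by fun_prop)
      (edge_ae_pos h) two_ne_zero hc ht)
  · intro h5
    obtain ⟨c, hc, ht⟩ := bandLaw_edge_upper ha h5
    exact (lintegral_inv_sq_lt_top (Y := fun x => |x + ∑ k, a k|) (by fun_prop)
      (edge_ae_pos h) hc ht).ne

end Edge

/-! ### Multiplication operators with a rank one perturbation -/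

section RankOneModel

variable {Ω : Type*} [MeasurableSpace Ω] {m : Measure Ω} {E : Type*} [NormedAddCommGroup E]
  [NormedSpace ℂ E]

/-- `V` carries the operator `T` to multiplication by `h` plus `μ` times the projection onto the
constants. -/
def IsRankOneModel (V : E ≃ₗᵢ[ℂ] Lp ℂ 2 m) (T : E →L[ℂ] E) (h : Ω → ℝ) (μ : ℝ) : Prop :=
  ∀ u, V (T u) =ᵐ[m] fun x => h x * V u x + μ * ∫ y, V u y ∂m

variable {V : E ≃ₗᵢ[ℂ] Lp ℂ 2 m} {T : E →L[ℂ] E} {h : Ω → ℝ} {μ : ℝ} {z : ℂ}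

theorem IsRankOneModel.sub_smul (hM : IsRankOneModel V T h μ) (z : ℂ) (u : E) :
    V (T u - z • u) =ᵐ[m] fun x => (h x - z) * V u x + μ * ∫ y, V u y ∂m := by
  rw [map_sub, map_smul]
  filter_upwards [hM u, Lp.coeFn_sub (V (T u)) (z • V u), Lp.coeFn_smul z (V u)] with x h1 h2 h3
  rw [h2, Pi.sub_apply, h1, h3, Pi.smul_apply, smul_eq_mul]
  ring

theorem mem_pointSpectrum_iff : z ∈ pointSpectrum T ↔ ∃ u : E, u ≠ 0 ∧ T u - z • u = 0 := by
  constructor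
  · intro hz
    obtain ⟨u, hu⟩ := Module.End.HasEigenvalue.exists_hasEigenvector hz
    exact ⟨u, hu.2, sub_eq_zero.2 hu.apply_eq_smul⟩
  · rintro ⟨u, hu, h0⟩
    exact Module.End.hasEigenvalue_of_hasEigenvector
      ⟨Module.End.mem_eigenspace_iff.2 (sub_eq_zero.1 h0), hu⟩

theorem IsRankOneModel.eigenvector_eq (hM : IsRankOneModel V T h μ)
    (hz : ∀ᵐ x ∂m, (h x : ℂ) ≠ z) {u : E} (hu : T u - z • u = 0) :
    V u =ᵐ[m] fun x => (-μ * ∫ y, V u y ∂m) * (h x - z)⁻¹ := by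
  have h1 := hM.sub_smul z u
  rw [hu, map_zero] at h1
  filter_upwards [h1, hz, Lp.coeFn_zero ℂ 2 m] with x h2 h3 h4
  rw [h4, Pi.zero_apply] at h2
  have h5 : (h x : ℂ) - z ≠ 0 := sub_ne_zero.2 h3
  rw [← div_eq_mul_inv, eq_div_iff h5]
  linear_combination -h2

/-- An eigenvector is a multiple of `(h - z)⁻¹`, with a factor that is nonzero since the eigenvector
is. Integrating this identity and cancelling the integral of the eigenvector gives the scalar
equation. -/
theorem IsRankOneModel.of_mem_pointSpectrum (hM : IsRankOneModel V T h μ)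
    (hz : ∀ᵐ x ∂m, (h x : ℂ) ≠ z) (hmem : z ∈ pointSpectrum T) :
    MemLp (fun x => ((h x : ℂ) - z)⁻¹) 2 m ∧ 1 + μ * ∫ x, ((h x : ℂ) - z)⁻¹ ∂m = 0 := by
  obtain ⟨u, hu, h0⟩ := mem_pointSpectrum_iff.1 hmem
  have h1 := hM.eigenvector_eq hz h0
  set I := ∫ y, V u y ∂m with hI
  have hc : -(μ : ℂ) * I ≠ 0 := by
    intro hc
    rw [hc] at h1
    refine hu ((map_eq_zero_iff V V.injective).1 ?_)
    rw [Lp.eq_zero_iff_ae_eq_zero]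
    filter_upwards [h1] with x hx
    simpa using hx
  have hI0 : I ≠ 0 := right_ne_zero_of_mul hc
  constructor
  · have h2 := (((Lp.memLp (V u)).ae_eq h1).const_mul (-(μ : ℂ) * I)⁻¹)
    refine h2.ae_eq (Filter.Eventually.of_forall fun x => ?_)
    simp only
    rw [← mul_assoc, inv_mul_cancel₀ hc, one_mul]
  · have h2 := integral_congr_ae h1
    rw [integral_const_mul, ← hI] at h2
    refine mul_left_cancel₀ hI0 ?_
    linear_combination h2

theorem IsRankOneModel.mem_pointSpectrum [IsProbabilityMeasure m] (hM : IsRankOneModel V T h μ)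
    (hz : ∀ᵐ x ∂m, (h x : ℂ) ≠ z) (hL : MemLp (fun x => ((h x : ℂ) - z)⁻¹) 2 m)
    (heq : 1 + μ * ∫ x, ((h x : ℂ) - z)⁻¹ ∂m = 0) : z ∈ pointSpectrum T := by
  refine mem_pointSpectrum_iff.2 ⟨V.symm (hL.toLp _), fun h0 => ?_, ?_⟩
  · rw [map_eq_zero_iff _ V.symm.injective, Lp.eq_zero_iff_ae_eq_zero] at h0
    have : ∀ᵐ _ ∂m, False := by
      filter_upwards [h0, hL.coeFn_toLp, hz] with x h1 h2 h3
      rw [h2] at h1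
      exact inv_ne_zero (sub_ne_zero.2 h3) h1
    exact this.exists.elim fun _ hx => hx
  · refine (map_eq_zero_iff V V.injective).1 ?_
    rw [Lp.eq_zero_iff_ae_eq_zero]
    have h1 := hM.sub_smul z (V.symm (hL.toLp _))
    rw [V.apply_symm_apply] at h1
    rw [integral_congr_ae hL.coeFn_toLp] at h1
    filter_upwards [h1, hL.coeFn_toLp, hz] with x h2 h3 h4
    rw [h2, h3, mul_inv_cancel₀ (sub_ne_zero.2 h4), heq, Pi.zero_apply]

/-- The imaginary part of the scalar equation makes `Im z` times the integral of `|h - z|⁻²` vanish,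
and that integral is positive. -/
theorem IsRankOneModel.eigenvalue_im [IsProbabilityMeasure m] (hM : IsRankOneModel V T h μ)
    (hmem : z ∈ pointSpectrum T) : z.im = 0 := by
  by_contra him
  have hne (x : Ω) : (h x : ℂ) ≠ z := fun h0 => him (by rw [← h0, Complex.ofReal_im])
  obtain ⟨hL, heq⟩ := hM.of_mem_pointSpectrum (Filter.Eventually.of_forall hne) hmem
  have hint : Integrable (fun x => ((h x : ℂ) - z)⁻¹) m := hL.integrable (by norm_num)
  have hμ : μ ≠ 0 := by
    rintro rfl
    simp at heq
  have h1 : (∫ x, ((h x : ℂ) - z)⁻¹ ∂m).im = 0 := by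
    have := congrArg Complex.im heq
    simpa [hμ] using this
  have h2 : ∫ x, (Complex.normSq ((h x : ℂ) - z))⁻¹ ∂m = 0 := by
    have h3 : ∫ x, (((h x : ℂ) - z)⁻¹).im ∂m = 0 := by
      rw [← h1]
      exact integral_im hint
    have h4 (x : Ω) : (((h x : ℂ) - z)⁻¹).im = z.im * (Complex.normSq ((h x : ℂ) - z))⁻¹ := by
      rw [Complex.inv_im]
      simp [div_eq_mul_inv]
    simp only [h4] at h3
    rw [integral_const_mul] at h3
    exact (mul_eq_zero.1 h3).resolve_left him
  have hpos (x : Ω) : 0 < (Complex.normSq ((h x : ℂ) - z))⁻¹ :=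
    inv_pos.2 (Complex.normSq_pos.2 (sub_ne_zero.2 (hne x)))
  have hint' : Integrable (fun x => (Complex.normSq ((h x : ℂ) - z))⁻¹) m := by
    have := hL.integrable_norm_pow (p := 2) two_ne_zero
    refine this.congr (Filter.Eventually.of_forall fun x => ?_)
    simp only [norm_inv, inv_pow, Complex.normSq_eq_norm_sq]
  rw [integral_eq_zero_iff_of_nonneg (fun x => (hpos x).le) hint'] at h2
  exact h2.exists.elim fun x hx => (hpos x).ne' hx

theorem IsRankOneModel.finiteDimensional_eigenspace (hM : IsRankOneModel V T h μ)
    (hz : ∀ᵐ x ∂m, (h x : ℂ) ≠ z) (hmem : z ∈ pointSpectrum T) :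
    FiniteDimensional ℂ (Module.End.eigenspace (T : E →ₗ[ℂ] E) z) := by
  obtain ⟨hL, -⟩ := hM.of_mem_pointSpectrum hz hmem
  refine Submodule.finiteDimensional_of_le (S₂ := Submodule.span ℂ {V.symm (hL.toLp _)}) ?_
  intro u hu
  have h0 : T u - z • u = 0 := sub_eq_zero.2 (Module.End.mem_eigenspace_iff.1 hu)
  refine Submodule.mem_span_singleton.2 ⟨-μ * ∫ y, V u y ∂m, V.injective ?_⟩
  rw [map_smul, V.apply_symm_apply]
  refine Lp.ext ?_
  filter_upwards [hM.eigenvector_eq hz h0, Lp.coeFn_smul (-(μ : ℂ) * ∫ y, V u y ∂m) (hL.toLp _),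
    hL.coeFn_toLp] with x h1 h2 h3
  rw [h2, Pi.smul_apply, h3, h1, smul_eq_mul]

theorem mem_resolvent_of_bijective [CompleteSpace E]
    (hb : Function.Bijective fun u => T u - z • u) : z ∉ spectrum ℂ T := by
  rw [spectrum.notMem_iff, ← IsUnit.neg_iff, ContinuousLinearMap.isUnit_iff_bijective]
  convert hb using 1
  funext u
  simp [Algebra.algebraMap_eq_smul_one]

/-- At a positive distance from the values of `h` the equation `(T - z) u = v` is solved explicitly.
The only obstruction is `D = 0`, which would make `(h - z)⁻¹` an eigenfunction. -/
theorem IsRankOneModel.notMem_spectrum [IsProbabilityMeasure m] [CompleteSpace E]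
    (hh : Measurable h) (hM : IsRankOneModel V T h μ) {δ : ℝ} (hδ : 0 < δ)
    (hz : ∀ x, δ ≤ ‖(h x : ℂ) - z‖) (hmem : z ∉ pointSpectrum T) : z ∉ spectrum ℂ T := by
  have hne (x : Ω) : (h x : ℂ) - z ≠ 0 := norm_pos_iff.1 (hδ.trans_le (hz x))
  have hK : AEStronglyMeasurable (fun x => ((h x : ℂ) - z)⁻¹) m :=
    (by fun_prop : Measurable fun x => ((h x : ℂ) - z)⁻¹).aestronglyMeasurable
  have hbd (x : Ω) : ‖((h x : ℂ) - z)⁻¹‖ ≤ δ⁻¹ := by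
    rw [norm_inv]
    exact inv_anti₀ hδ (hz x)
  have hL : MemLp (fun x => ((h x : ℂ) - z)⁻¹) 2 m :=
    MemLp.of_bound hK _ (Filter.Eventually.of_forall hbd)
  have hD : 1 + μ * ∫ x, ((h x : ℂ) - z)⁻¹ ∂m ≠ 0 := fun h0 =>
    hmem (hM.mem_pointSpectrum (Filter.Eventually.of_forall fun x => sub_ne_zero.1 (hne x)) hL h0)
  refine mem_resolvent_of_bijective ⟨fun u v huv => ?_, fun v => ?_⟩
  · by_contra hne'
    refine hmem (mem_pointSpectrum_iff.2 ⟨u - v, sub_ne_zero.2 hne', ?_⟩)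
    have huv' : T u - z • u = T v - z • v := huv
    rw [map_sub, smul_sub, sub_sub_sub_comm, huv', sub_self]
  · have hg := Lp.memLp (V v)
    have hgK : MemLp (fun x => ((h x : ℂ) - z)⁻¹ * V v x) 2 m :=
      hg.of_le_mul (c := δ⁻¹) (hK.mul hg.1) (Filter.Eventually.of_forall fun x => by
        rw [norm_mul]
        exact mul_le_mul_of_nonneg_right (hbd x) (norm_nonneg _))
    set D := 1 + μ * ∫ x, ((h x : ℂ) - z)⁻¹ ∂m with hDdef
    -- The value that the integral of the solution must have: integrating `f = (h - z)⁻¹ (v - μ I)`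
    -- gives `I D = ∫ (h - z)⁻¹ v`.
    set I := (∫ x, ((h x : ℂ) - z)⁻¹ * V v x ∂m) / D with hI
    have hf : MemLp (fun x => ((h x : ℂ) - z)⁻¹ * V v x - μ * I * ((h x : ℂ) - z)⁻¹) 2 m :=
      hgK.sub (hL.const_mul _)
    have hint : ∫ x, (((h x : ℂ) - z)⁻¹ * V v x - μ * I * ((h x : ℂ) - z)⁻¹) ∂m = I := by
      rw [integral_sub (hgK.integrable (by norm_num)) ((hL.integrable (by norm_num)).const_mul _),
        integral_const_mul]
      have : ∫ x, ((h x : ℂ) - z)⁻¹ * V v x ∂m = I * D := by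
        rw [hI, div_mul_cancel₀ _ hD]
      rw [this, hDdef]
      ring
    refine ⟨V.symm (hf.toLp _), V.injective (Lp.ext ?_)⟩
    have h1 := hM.sub_smul z (V.symm (hf.toLp _))
    rw [V.apply_symm_apply, integral_congr_ae hf.coeFn_toLp, hint] at h1
    filter_upwards [h1, hf.coeFn_toLp] with x h2 h3
    rw [h2, h3]
    have := hne x
    field_simp
    ring

end RankOneModel

/-! ### Fourier synthesis on the lattice -/

section Fourier

variable {d : ℕ}

/-- Fourier synthesis `l₂(ℤ^d) → L²((ℝ/ℤ)^d)`. -/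
def synthesis (d : ℕ) : L2Z d ≃ₗᵢ[ℂ] Lp ℂ 2 (haarTorus d) :=
  (UnitAddTorus.mFourierBasis (d := Fin d)).repr.symm

theorem synthesis_symm_apply (f : Lp ℂ 2 (haarTorus d)) (n : Fin d → ℤ) :
    (synthesis d).symm f n = ∫ x, UnitAddTorus.mFourier (-n) x * f x ∂haarTorus d :=
  UnitAddTorus.mFourierBasis_repr f n

theorem apply_eq_integral (u : L2Z d) (n : Fin d → ℤ) :
    u n = ∫ x, UnitAddTorus.mFourier (-n) x * synthesis d u x ∂haarTorus d := by
  rw [← synthesis_symm_apply, (synthesis d).symm_apply_apply]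

theorem integral_synthesis (u : L2Z d) : ∫ x, synthesis d u x ∂haarTorus d = u 0 := by
  rw [apply_eq_integral u 0]
  simp [UnitAddTorus.mFourier_zero]

theorem norm_mFourier_apply (n : Fin d → ℤ) (x : UnitAddTorus (Fin d)) :
    ‖UnitAddTorus.mFourier n x‖ = 1 := by
  simp only [UnitAddTorus.mFourier, fourier_apply, ContinuousMap.coe_mk, norm_prod,
    Circle.norm_coe, Finset.prod_const_one]

/-- Both sides have the same Fourier coefficients, since multiplication by a character translates
them. -/
theorem synthesis_shift (n : Fin d → ℤ) (u : L2Z d) :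
    synthesis d (shift (-n) u) =ᵐ[haarTorus d]
      fun x => UnitAddTorus.mFourier n x * synthesis d u x := by
  have hu := Lp.memLp (synthesis d u)
  have hL : MemLp (fun x => UnitAddTorus.mFourier n x * synthesis d u x) 2 (haarTorus d) :=
    hu.of_le_mul (c := 1) ((UnitAddTorus.mFourier n).continuous.aestronglyMeasurable.mul hu.1)
      (Filter.Eventually.of_forall fun x => by rw [norm_mul, norm_mFourier_apply])
  have : shift (-n) u = (synthesis d).symm (hL.toLp _) := by
    refine lp.ext (funext fun x => ?_)
    rw [synthesis_symm_apply]
    have h1 : shift (-n) u x = u (x - n) := by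
      rw [sub_eq_add_neg]
      rfl
    rw [h1, apply_eq_integral]
    refine integral_congr_ae ?_
    filter_upwards [hL.coeFn_toLp] with y hy
    rw [hy, ← mul_assoc, ← UnitAddTorus.mFourier_add, neg_sub, sub_eq_neg_add]
  rw [this, (synthesis d).apply_symm_apply]
  exact hL.coeFn_toLp

theorem synthesis_deltaZero (u : L2Z d) :
    synthesis d (deltaZero d u) =ᵐ[haarTorus d] fun _ => u 0 := by
  have h1 : deltaZero d u = u 0 • lp.single 2 (0 : Fin d → ℤ) (1 : ℂ) := by
    rw [← lp.single_smul]
    simp [deltaZero, lp.evalCLM, lp.evalₗ]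
    rfl
  have h2 : synthesis d (lp.single 2 (0 : Fin d → ℤ) (1 : ℂ))
      = UnitAddTorus.mFourierLp (d := Fin d) 2 0 := by
    have := (UnitAddTorus.mFourierBasis (d := Fin d)).repr_symm_single 0
    rw [UnitAddTorus.coe_mFourierBasis] at this
    exact this
  rw [h1, map_smul, h2]
  filter_upwards [Lp.coeFn_smul (u 0) (UnitAddTorus.mFourierLp (d := Fin d) 2 0),
    UnitAddTorus.coeFn_mFourierLp (d := Fin d) 2 0] with x h3 h4
  rw [h3, Pi.smul_apply, h4, UnitAddTorus.mFourier_zero]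
  simp

end Fourier

/-! ### The symbol, and the band as part of the spectrum -/

section Symbol

variable {d : ℕ} {l₁ l₂ μ : ℝ} {φ : Fin d → ℝ}

/-- The normalized hopping amplitude in the direction `k`. -/
def amplitude (l₁ l₂ : ℝ) (φ : Fin d → ℝ) (k : Fin d) : ℂ :=
  (l₁ * Complex.exp (-Complex.I * φ k) + l₂) / (l₁ + l₂ : ℝ)

/-- The symbol of the free fibre Hamiltonian. -/
def symbol (l₁ l₂ : ℝ) (φ : Fin d → ℝ) (x : UnitAddTorus (Fin d)) : ℝ :=
  2 * (l₁ + l₂) * (d - trigSum (amplitude l₁ l₂ φ) x)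

theorem continuous_symbol : Continuous (symbol l₁ l₂ φ) := by
  have := continuous_trigSum (amplitude l₁ l₂ φ)
  unfold symbol
  fun_prop

theorem norm_amplitude (hL : 0 < l₁ + l₂) (k : Fin d) :
    ‖amplitude l₁ l₂ φ k‖ = r l₁ l₂ (φ k) := by
  rw [amplitude, r, norm_div, Complex.norm_real, Real.norm_of_nonneg hL.le]
  congr 1
  rw [← Real.sqrt_sq (norm_nonneg _), Complex.sq_norm]
  congr 1
  have h : (l₁ : ℂ) * Complex.exp (-Complex.I * φ k) + l₂
      = ((l₁ * Real.cos (φ k) + l₂ : ℝ) : ℂ) + ((-(l₁ * Real.sin (φ k)) : ℝ) : ℂ) * Complex.I := by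
    rw [show -Complex.I * (φ k : ℂ) = -(φ k : ℂ) * Complex.I by ring, Complex.exp_mul_I]
    push_cast
    rw [Complex.cos_neg, Complex.sin_neg]
    ring
  rw [h, Complex.normSq_add_mul_I]
  linear_combination l₁ ^ 2 * Real.sin_sq_add_cos_sq (φ k)

theorem r_nonneg (hL : 0 < l₁ + l₂) (α : ℝ) : 0 ≤ r l₁ l₂ α :=
  div_nonneg (Real.sqrt_nonneg _) hL.le

theorem measurePreserving_amplitude (hL : 0 < l₁ + l₂) :
    MeasurePreserving (trigSum (amplitude l₁ l₂ φ)) (haarTorus d)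
      (bandLaw fun k => r l₁ l₂ (φ k)) := by
  have := measurePreserving_trigSum (amplitude l₁ l₂ φ)
  simpa only [norm_amplitude hL] using this

/-- The two hopping coefficients in each direction are complex conjugates, as are the two
characters, so each pair of terms adds up to twice a real part. -/
theorem symbol_eq_complex (hL : 0 < l₁ + l₂) (x : UnitAddTorus (Fin d)) :
    (symbol l₁ l₂ φ x : ℂ) = -(∑ k, ((l₁ * Complex.exp (-Complex.I * φ k) + l₂) *
        UnitAddTorus.mFourier (e k) x + (l₁ * Complex.exp (Complex.I * φ k) + l₂) *
        UnitAddTorus.mFourier (-e k) x)) + 2 * d * (l₁ + l₂) := by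
  have hL' : ((l₁ + l₂ : ℝ) : ℂ) ≠ 0 := by exact_mod_cast hL.ne'
  have hk (k : Fin d) : (l₁ * Complex.exp (-Complex.I * φ k) + l₂) *
        UnitAddTorus.mFourier (e k) x + (l₁ * Complex.exp (Complex.I * φ k) + l₂) *
        UnitAddTorus.mFourier (-e k) x
      = 2 * (l₁ + l₂ : ℝ) * ((amplitude l₁ l₂ φ k * fourier 1 (x k)).re : ℂ) := by
    have h1 : (l₁ : ℂ) * Complex.exp (Complex.I * φ k) + l₂
        = (starRingEnd ℂ) (l₁ * Complex.exp (-Complex.I * φ k) + l₂) := by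
      simp [← Complex.exp_conj]
    have h2 : (l₁ : ℂ) * Complex.exp (-Complex.I * φ k) + l₂
        = (l₁ + l₂ : ℝ) * amplitude l₁ l₂ φ k := by
      rw [amplitude]
      field_simp
    rw [UnitAddTorus.mFourier_neg, h1, ← map_mul, Complex.add_conj, h2, e,
      UnitAddTorus.mFourier_single, mul_assoc, Complex.re_ofReal_mul]
    push_cast
    ring
  rw [Finset.sum_congr rfl fun k _ => hk k, ← Finset.mul_sum, symbol, trigSum]
  push_cast
  ring

theorem Lp_coeFn_sum {Ω ι : Type*} [MeasurableSpace Ω] {m : Measure Ω} (A : Finset ι)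
    {F : ι → Lp ℂ 2 m} {G : ι → Ω → ℂ} (h : ∀ k, F k =ᵐ[m] G k) :
    ⇑(∑ k ∈ A, F k) =ᵐ[m] fun x => ∑ k ∈ A, G k x := by
  classical
  induction A using Finset.induction_on with
  | empty =>
    simp only [Finset.sum_empty]
    exact Lp.coeFn_zero ℂ 2 m
  | insert k A hk ih =>
    rw [Finset.sum_insert hk]
    filter_upwards [Lp.coeFn_add (F k) (∑ k ∈ A, F k), h k, ih] with x h1 h2 h3
    rw [h1, Pi.add_apply, h2, h3, Finset.sum_insert hk]

/-- The form `- -e k` makes both translations match the pattern `shift (-n)` of `synthesis_shift`.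
-/
theorem hHat_eq (u : L2Z d) : hHat d l₁ l₂ μ φ u =
    -(∑ k, ((l₁ * Complex.exp (-Complex.I * φ k) + l₂) • shift (-e k) u
        + (l₁ * Complex.exp (Complex.I * φ k) + l₂) • shift (- -e k) u))
      + ((2 * d * (l₁ + l₂) : ℝ) : ℂ) • u + (μ : ℂ) • deltaZero d u := by
  simp only [hHat, add_apply, neg_apply, sum_apply, smul_apply, neg_neg,
    ContinuousLinearMap.id_apply, LinearIsometry.coe_toContinuousLinearMap]

theorem isRankOneModel_hHat (hL : 0 < l₁ + l₂) :
    IsRankOneModel (synthesis d) (hHat d l₁ l₂ μ φ) (symbol l₁ l₂ φ) μ := by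
  intro u
  rw [hHat_eq, integral_synthesis]
  simp only [map_add, map_neg, map_sum, map_smul]
  set V := synthesis d
  have hs (n : Fin d → ℤ) (c : ℂ) : ⇑(c • V (shift (-n) u)) =ᵐ[haarTorus d]
      fun x => c * (UnitAddTorus.mFourier n x * V u x) := by
    filter_upwards [Lp.coeFn_smul c (V (shift (-n) u)), synthesis_shift n u] with x h2 h3
    rw [h2, Pi.smul_apply, h3, smul_eq_mul]
  have hsum := Lp_coeFn_sum (m := haarTorus d) Finset.univ
    (F := fun k : Fin d => (l₁ * Complex.exp (-Complex.I * φ k) + l₂) • V (shift (-e k) u)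
      + (l₁ * Complex.exp (Complex.I * φ k) + l₂) • V (shift (- -e k) u))
    (G := fun k x => (l₁ * Complex.exp (-Complex.I * φ k) + l₂) *
        (UnitAddTorus.mFourier (e k) x * V u x)
      + (l₁ * Complex.exp (Complex.I * φ k) + l₂) *
        (UnitAddTorus.mFourier (-e k) x * V u x)) fun k => by
      filter_upwards [Lp.coeFn_add ((l₁ * Complex.exp (-Complex.I * φ k) + l₂) •
        V (shift (-e k) u)) ((l₁ * Complex.exp (Complex.I * φ k) + l₂) • V (shift (- -e k) u)),
        hs (e k) (l₁ * Complex.exp (-Complex.I * φ k) + l₂),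
        hs (-e k) (l₁ * Complex.exp (Complex.I * φ k) + l₂)] with x h1 h2 h3
      rw [h1, Pi.add_apply, h2, h3]
  set F := ∑ k, ((l₁ * Complex.exp (-Complex.I * φ k) + l₂) • V (shift (-e k) u)
      + (l₁ * Complex.exp (Complex.I * φ k) + l₂) • V (shift (- -e k) u))
  set c : ℂ := ((2 * d * (l₁ + l₂) : ℝ) : ℂ) with hc
  filter_upwards [hsum, Lp.coeFn_add (-F + c • V u) ((μ : ℂ) • V (deltaZero d u)),
    Lp.coeFn_add (-F) (c • V u), Lp.coeFn_neg F, Lp.coeFn_smul c (V u),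
    Lp.coeFn_smul (μ : ℂ) (V (deltaZero d u)), synthesis_deltaZero u] with x h1 h2 h3 h4 h5 h6 h7
  rw [h2, Pi.add_apply, h3, Pi.add_apply, h4, Pi.neg_apply, h1, h5, h6, Pi.smul_apply,
    Pi.smul_apply, h7, symbol_eq_complex hL, hc, smul_eq_mul, smul_eq_mul]
  simp only [← mul_assoc, ← add_mul, ← Finset.sum_mul]
  push_cast
  ring

/-- Along the curve on which all phases, corrected by the arguments of the amplitudes, equal `α`,
the symbol runs continuously from one edge to the other. -/
theorem exists_symbol_eq (hL : 0 < l₁ + l₂) {v : ℝ}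
    (hv : v ∈ Set.Icc (β₁ l₁ l₂ φ) (β₂ l₁ l₂ φ)) : ∃ x, symbol l₁ l₂ φ x = v := by
  let γ : ℝ → UnitAddTorus (Fin d) := fun α k =>
    (((α - (amplitude l₁ l₂ φ k).arg) / (2 * Real.pi) : ℝ) : UnitAddCircle)
  have hγ (α : ℝ) : symbol l₁ l₂ φ (γ α)
      = 2 * (l₁ + l₂) * (d - (∑ k, r l₁ l₂ (φ k)) * Real.cos α) := by
    rw [symbol, trigSum_angle (amplitude l₁ l₂ φ) (fun _ => α)]
    simp only [cosSum, norm_amplitude hL, Finset.sum_mul]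
  have hcont : ContinuousOn (fun α => symbol l₁ l₂ φ (γ α)) (Set.Icc 0 Real.pi) := by
    simp only [hγ]
    fun_prop
  have hmem : v ∈ Set.Icc (symbol l₁ l₂ φ (γ 0)) (symbol l₁ l₂ φ (γ Real.pi)) := by
    rw [hγ, hγ, Real.cos_zero, Real.cos_pi]
    refine ⟨le_trans (le_of_eq ?_) hv.1, hv.2.trans (le_of_eq ?_)⟩
    · rw [β₁]
      ring
    · rw [β₂]
      ring
  obtain ⟨α, -, hα⟩ := intermediate_value_Icc Real.pi_pos.le hcont hmem
  exact ⟨γ α, hα⟩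

theorem symbol_mem (hL : 0 < l₁ + l₂) (x : UnitAddTorus (Fin d)) :
    symbol l₁ l₂ φ x ∈ Set.Icc (β₁ l₁ l₂ φ) (β₂ l₁ l₂ φ) := by
  have h : |trigSum (amplitude l₁ l₂ φ) x| ≤ ∑ k, r l₁ l₂ (φ k) := by
    refine (Finset.abs_sum_le_sum_abs _ _).trans (Finset.sum_le_sum fun k _ => ?_)
    refine (Complex.abs_re_le_norm _).trans (le_of_eq ?_)
    rw [norm_mul, norm_amplitude hL, fourier_apply, Circle.norm_coe, mul_one]
  have := abs_le.1 h
  constructor <;> rw [symbol]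
  · rw [β₁]
    exact mul_le_mul_of_nonneg_left (by linarith) (by positivity)
  · rw [β₂]
    exact mul_le_mul_of_nonneg_left (by linarith) (by positivity)

theorem exists_symbol_gap {z : ℂ}
    (hz : z ∉ Complex.ofReal '' Set.Icc (β₁ l₁ l₂ φ) (β₂ l₁ l₂ φ)) :
    ∃ δ > 0, ∀ w ∈ Complex.ofReal '' Set.Icc (β₁ l₁ l₂ φ) (β₂ l₁ l₂ φ), δ ≤ ‖w - z‖ := by
  have hcl : IsClosed (Complex.ofReal '' Set.Icc (β₁ l₁ l₂ φ) (β₂ l₁ l₂ φ)) :=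
    (isCompact_Icc.image Complex.continuous_ofReal).isClosed
  obtain ⟨δ, hδ, hsub⟩ := Metric.isOpen_iff.1 hcl.isOpen_compl z hz
  refine ⟨δ, hδ, fun w hw => ?_⟩
  by_contra! hlt
  exact hsub (by rwa [Metric.mem_ball, dist_eq_norm]) hw

theorem shift_hHat_zero (y : Fin d → ℤ) (u : L2Z d) :
    hHat d l₁ l₂ 0 φ (shift y u) = shift y (hHat d l₁ l₂ 0 φ u) := by
  refine lp.ext (funext fun x => ?_)
  have hs (v : L2Z d) (x : Fin d → ℤ) : shift y v x = v (x + y) := rfl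
  rw [hs, hHat_apply, hHat_apply]
  simp only [hs, Complex.ofReal_zero, zero_mul, add_zero, add_sub_right_comm, add_right_comm]

theorem hHat_eq_zero_add (u : L2Z d) :
    hHat d l₁ l₂ μ φ u = hHat d l₁ l₂ 0 φ u + (μ : ℂ) • deltaZero d u := by
  rw [hHat_eq, hHat_eq, Complex.ofReal_zero, zero_smul, add_zero]

theorem norm_deltaZero (u : L2Z d) : ‖deltaZero d u‖ = ‖u 0‖ :=
  lp.norm_single (p := 2) (E := fun _ : Fin d → ℤ => ℂ) (by norm_num) 0 (u 0)

theorem exists_apply_lt (hd : 1 ≤ d) (u : L2Z d) {ε : ℝ} (hε : 0 < ε) : ∃ y, ‖u y‖ < ε := by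
  have : Nonempty (Fin d) := ⟨⟨0, hd⟩⟩
  have hsum := (lp.memℓp u).summable (by norm_num)
  obtain ⟨y, hy⟩ := (hsum.tendsto_cofinite_zero.eventually
    (gt_mem_nhds (show 0 < ε ^ (2 : ENNReal).toReal by positivity))).exists
  exact ⟨y, lt_of_not_ge fun hge => absurd hy (not_lt.2
    (Real.rpow_le_rpow hε.le hge (by norm_num)))⟩

theorem exists_bound_of_notMem_spectrum {E : Type*} [NormedAddCommGroup E] [NormedSpace ℂ E]
    {T : E →L[ℂ] E} {z : ℂ} (hz : z ∉ spectrum ℂ T) :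
    ∃ K > 0, ∀ u, ‖u‖ ≤ K * ‖T u - z • u‖ := by
  rw [spectrum.notMem_iff, ← IsUnit.neg_iff] at hz
  obtain ⟨R, hR⟩ := hz.exists_left_inv
  refine ⟨‖R‖ + 1, by positivity, fun u => ?_⟩
  have h1 : R (T u - z • u) = u := by
    have := congrArg (fun T : E →L[ℂ] E => T u) hR
    simpa [Algebra.algebraMap_eq_smul_one] using this
  calc ‖u‖ = ‖R (T u - z • u)‖ := by rw [h1]
    _ ≤ ‖R‖ * ‖T u - z • u‖ := R.le_opNorm _
    _ ≤ _ := by gcongr; linarith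

/-- Weyl's argument: a packet concentrated where the symbol is close to `v` nearly solves the free
equation, and its translates do so equally well. Far translates are almost zero at the origin, so
the interaction cannot restore a bounded inverse. -/
theorem Icc_subset_spectrum (hd : 1 ≤ d) (hL : 0 < l₁ + l₂) :
    Complex.ofReal '' Set.Icc (β₁ l₁ l₂ φ) (β₂ l₁ l₂ φ) ⊆ spectrum ℂ (hHat d l₁ l₂ μ φ) := by
  rintro _ ⟨v, hv, rfl⟩
  by_contra hspec
  obtain ⟨K, hK0, hbelow⟩ := exists_bound_of_notMem_spectrum hspec
  -- With this width the free residual accounts for at most half of `‖u‖` in the bound with constant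
  -- `K`.
  let U : Set (UnitAddTorus (Fin d)) := {x | |symbol l₁ l₂ φ x - v| < (2 * K)⁻¹}
  have hUo : IsOpen U := isOpen_lt
    ((continuous_symbol.sub continuous_const).abs) continuous_const
  have hUm : haarTorus d U ≠ ⊤ := measure_ne_top _ _
  have hUpos : 0 < haarTorus d U := by
    obtain ⟨x, hx⟩ := exists_symbol_eq hL hv
    refine hUo.measure_pos _ ⟨x, ?_⟩
    simp only [U, Set.mem_ofPred_eq, hx, sub_self, abs_zero]
    positivity
  let f : Lp ℂ 2 (haarTorus d) := indicatorConstLp 2 hUo.measurableSet hUm 1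
  set u : L2Z d := (synthesis d).symm f with hu
  have hfu : synthesis d u = f := (synthesis d).apply_symm_apply f
  have hupos : 0 < ‖u‖ := by
    rw [hu, LinearIsometryEquiv.norm_map, norm_indicatorConstLp two_ne_zero ENNReal.ofNat_ne_top]
    have : 0 < (haarTorus d).real U := ENNReal.toReal_pos hUpos.ne' hUm
    simp only [norm_one, one_mul]
    positivity
  have hfree : ‖hHat d l₁ l₂ 0 φ u - (v : ℂ) • u‖ ≤ (2 * K)⁻¹ * ‖u‖ := by
    rw [← (synthesis d).norm_map, ← (synthesis d).norm_map u]
    refine Lp.norm_le_mul_norm_of_ae_le_mul ?_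
    filter_upwards [(isRankOneModel_hHat (μ := 0) (φ := φ) hL).sub_smul v u,
      indicatorConstLp_coeFn (p := 2) (hs := hUo.measurableSet) (hμs := hUm) (c := (1 : ℂ))]
      with x h1 h2
    rw [h1, hfu, h2, Complex.ofReal_zero, zero_mul, add_zero, norm_mul]
    by_cases hx : x ∈ U
    · refine mul_le_mul_of_nonneg_right ?_ (norm_nonneg _)
      rw [← Complex.ofReal_sub, Complex.norm_real]
      exact le_of_lt hx
    · simp [hx]
  have hfar (y : Fin d → ℤ) : ‖u‖ ≤ 2 * K * (|μ| * ‖u y‖) := by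
    have h1 : hHat d l₁ l₂ μ φ (shift y u) - (v : ℂ) • shift y u
        = shift y (hHat d l₁ l₂ 0 φ u - (v : ℂ) • u) + (μ : ℂ) • deltaZero d (shift y u) := by
      rw [hHat_eq_zero_add, shift_hHat_zero, map_sub, map_smul]
      abel
    have h2 : shift y u 0 = u y := by
      have : shift y u 0 = u (0 + y) := rfl
      rw [this, zero_add]
    have h3 := hbelow (shift y u)
    rw [h1, LinearIsometry.norm_map] at h3
    have h4 := norm_add_le (shift y (hHat d l₁ l₂ 0 φ u - (v : ℂ) • u))
      ((μ : ℂ) • deltaZero d (shift y u))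
    rw [LinearIsometry.norm_map, norm_smul, norm_deltaZero, h2, Complex.norm_real,
      Real.norm_eq_abs] at h4
    have h5 := h3.trans (mul_le_mul_of_nonneg_left (h4.trans (add_le_add_left hfree _)) hK0.le)
    have h6 : K * ((2 * K)⁻¹ * ‖u‖ + |μ| * ‖u y‖) = ‖u‖ / 2 + K * (|μ| * ‖u y‖) := by
      field_simp
    rw [h6] at h5
    linarith
  -- The summand `1` in `|μ| + 1` keeps the denominator positive when `μ = 0`.
  obtain ⟨y, hy⟩ := exists_apply_lt hd u (ε := ‖u‖ / (2 * K * (|μ| + 1))) (by positivity)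
  have h1 := hfar y
  rw [lt_div_iff₀ (by positivity)] at hy
  have h2 : 0 ≤ 2 * K * ‖u y‖ := by positivity
  nlinarith

end Symbol

/-! ### From the fibre operator to the band law -/

section Translation

variable {d : ℕ} {l₁ l₂ μ : ℝ} {φ : Fin d → ℝ}

/-- The coefficients `r(φ_k)`. -/
abbrev rvec (l₁ l₂ : ℝ) (φ : Fin d → ℝ) : Fin d → ℝ := fun k => r l₁ l₂ (φ k)

theorem s_eq_numNonzero : s l₁ l₂ φ = numNonzero (rvec l₁ l₂ φ) := by
  classical
  rw [s, numNonzero, Set.ncard_eq_toFinset_card']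
  congr 1
  ext k
  simp

theorem s_le : s l₁ l₂ φ ≤ d := by
  rw [s_eq_numNonzero, numNonzero]
  exact (Finset.card_le_univ _).trans (by simp)

theorem exists_r_ne_zero (hs : 1 ≤ s l₁ l₂ φ) : ∃ k, rvec l₁ l₂ φ k ≠ 0 := by
  rw [s_eq_numNonzero, numNonzero] at hs
  obtain ⟨k, hk⟩ := Finset.card_pos.1 hs
  exact ⟨k, (Finset.mem_filter.1 hk).2⟩

theorem r_eq_zero (hs : s l₁ l₂ φ = 0) (k : Fin d) : r l₁ l₂ (φ k) = 0 := by
  rw [s_eq_numNonzero, numNonzero, Finset.card_eq_zero, Finset.filter_eq_empty_iff] at hs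
  exact not_not.1 (hs (Finset.mem_univ k))

/-- The radicand is at least `(λ₁ - λ₂)²`, so only equal hopping constants can switch off a
direction. -/
theorem s_eq_of_ne (hl₁ : 0 < l₁) (hl₂ : 0 < l₂) (hne : l₁ ≠ l₂) : s l₁ l₂ φ = d := by
  rw [s_eq_numNonzero, numNonzero, Finset.filter_true_of_mem, Finset.card_univ, Fintype.card_fin]
  intro k _
  refine (div_pos (Real.sqrt_pos.2 ?_) (by positivity)).ne'
  have h1 := Real.neg_one_le_cos (φ k)
  have h2 : 0 < (l₁ - l₂) ^ 2 := by
    have := sub_ne_zero.2 hne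
    positivity
  nlinarith [mul_pos hl₁ hl₂]

theorem c_eq_edgeMean :
    c d l₁ l₂ φ = edgeMean (bandLaw (rvec l₁ l₂ φ)) (∑ k, r l₁ l₂ (φ k)) := by
  rw [edgeMean, bandLaw, lintegral_map (by fun_prop) (measurable_cosSum _), phaseLaw_eq,
    lintegral_smul_measure, c, smul_eq_mul]
  simp only [sum_sub_cosSum]

theorem eigenIntegrand_eq (ν : ℝ) : eigenIntegrand l₁ l₂ φ ν =
    fun ψ => (cosSum (rvec l₁ l₂ φ) ψ + (ν / (2 * (l₁ + l₂)) - d))⁻¹ := by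
  funext ψ
  rw [eigenIntegrand, one_div, cosSum]
  congr 1
  ring

theorem solvesEigenEquation_iff (ν : ℝ) : SolvesEigenEquation l₁ l₂ μ φ ν ↔
    ResolventMean (bandLaw (rvec l₁ l₂ φ)) (2 * (l₁ + l₂) / μ)
      (ν / (2 * (l₁ + l₂)) - d) := by
  have hpi := Real.pi_pos
  have hN0 : (ENNReal.ofReal ((2 * Real.pi) ^ d))⁻¹ ≠ 0 := by simp
  have hN1 : (ENNReal.ofReal ((2 * Real.pi) ^ d))⁻¹ ≠ ⊤ := by
    simp only [ne_eq, ENNReal.inv_eq_top, ENNReal.ofReal_eq_zero, not_le]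
    positivity
  have hmeas := kernel_measurable (ν / (2 * (l₁ + l₂)) - d)
  rw [SolvesEigenEquation, ResolventMean, bandLaw,
    integrable_map_measure hmeas.aestronglyMeasurable (measurable_cosSum _).aemeasurable,
    integral_map (measurable_cosSum _).aemeasurable hmeas.aestronglyMeasurable, phaseLaw_eq,
    integrable_smul_measure hN0 hN1, integral_smul_measure, ENNReal.toReal_inv,
    ENNReal.toReal_ofReal (by positivity), smul_eq_mul, one_div, eigenIntegrand_eq, IntegrableOn,
    Function.comp_def]

theorem isBandLaw_rvec (hL : 0 < l₁ + l₂) (hs : 1 ≤ s l₁ l₂ φ) :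
    IsBandLaw (bandLaw (rvec l₁ l₂ φ)) (∑ k, r l₁ l₂ (φ k)) := by
  obtain ⟨k, hk⟩ := exists_r_ne_zero hs
  exact isBandLaw_bandLaw (fun k => r_nonneg hL _) hk

/-- One active direction makes the law atomless, so level sets of the symbol are null and the rank
one criterion applies at every `z`, even inside the band. -/
theorem symbol_ae_ne (hL : 0 < l₁ + l₂) (hs : 1 ≤ s l₁ l₂ φ) (z : ℂ) :
    ∀ᵐ x ∂haarTorus d, (symbol l₁ l₂ φ x : ℂ) ≠ z := by
  have h1 := (isBandLaw_rvec hL hs).ae_ne (d - z.re / (2 * (l₁ + l₂)))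
  have h2 := (measurePreserving_amplitude (φ := φ) hL).quasiMeasurePreserving.ae h1
  filter_upwards [h2] with x hx hz
  refine hx ?_
  rw [← hz, Complex.ofReal_re, symbol]
  field_simp
  ring

theorem symbol_resolvent_eq (hL : 0 < l₁ + l₂) (ν : ℝ) (x : UnitAddTorus (Fin d)) :
    ((symbol l₁ l₂ φ x : ℂ) - ν)⁻¹ = ((-(2 * (l₁ + l₂))⁻¹ *
      (trigSum (amplitude l₁ l₂ φ) x + (ν / (2 * (l₁ + l₂)) - d))⁻¹ : ℝ) : ℂ) := by
  rw [← Complex.ofReal_sub, ← Complex.ofReal_inv, ← inv_neg, ← mul_inv]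
  congr 2
  rw [symbol]
  field_simp
  ring

theorem mem_pointSpectrum_hHat_iff (hL : 0 < l₁ + l₂) (hs : 1 ≤ s l₁ l₂ φ) (hμ : μ ≠ 0)
    (ν : ℝ) : (ν : ℂ) ∈ pointSpectrum (hHat d l₁ l₂ μ φ) ↔
      MemLp (fun x => (x + (ν / (2 * (l₁ + l₂)) - d))⁻¹) 2 (bandLaw (rvec l₁ l₂ φ)) ∧
      ResolventMean (bandLaw (rvec l₁ l₂ φ)) (2 * (l₁ + l₂) / μ)
        (ν / (2 * (l₁ + l₂)) - d) := by
  set t := ν / (2 * (l₁ + l₂)) - d with ht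
  have hM := isRankOneModel_hHat (μ := μ) (φ := φ) hL
  have hz := symbol_ae_ne hL hs (ν : ℂ)
  have hmp := measurePreserving_amplitude (φ := φ) hL
  have hmeas := kernel_measurable t
  have hLp : MemLp (fun x => ((symbol l₁ l₂ φ x : ℂ) - ν)⁻¹) 2 (haarTorus d) ↔
      MemLp (fun x => (x + t)⁻¹) 2 (bandLaw (rvec l₁ l₂ φ)) := by
    rw [← hmp.map_eq, memLp_map_measure_iff hmeas.aestronglyMeasurable hmp.measurable.aemeasurable]
    have hmX : Measurable fun x => (trigSum (amplitude l₁ l₂ φ) x + t)⁻¹ :=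
      hmeas.comp hmp.measurable
    simp only [symbol_resolvent_eq hL, ← ht]
    have h2L : (2 * (l₁ + l₂)) ≠ 0 := by positivity
    constructor
    · intro h
      have h' := h.re.const_mul (-(2 * (l₁ + l₂)))
      refine h'.ae_eq (Filter.Eventually.of_forall fun x => ?_)
      simp only [RCLike.re_to_complex, Complex.ofReal_re, Function.comp_apply]
      rw [← mul_assoc, neg_mul_neg, mul_inv_cancel₀ h2L, one_mul]
    · intro h
      exact (h.const_mul (-(2 * (l₁ + l₂))⁻¹)).ofReal
  have hint : (1 + (μ : ℂ) * ∫ x, ((symbol l₁ l₂ φ x : ℂ) - ν)⁻¹ ∂haarTorus d = 0) ↔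
      2 * (l₁ + l₂) / μ = ∫ x, (x + t)⁻¹ ∂bandLaw (rvec l₁ l₂ φ) := by
    rw [← hmp.map_eq, integral_map hmp.measurable.aemeasurable hmeas.aestronglyMeasurable]
    simp only [symbol_resolvent_eq hL, ← ht]
    rw [integral_complex_ofReal, integral_const_mul, ← Complex.ofReal_mul, ← Complex.ofReal_one,
      ← Complex.ofReal_add, Complex.ofReal_eq_zero, div_eq_iff hμ]
    set G := ∫ x, (trigSum (amplitude l₁ l₂ φ) x + t)⁻¹ ∂haarTorus d
    have h2L : (2 * (l₁ + l₂)) ≠ 0 := by positivity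
    constructor
    · intro h
      field_simp at h
      linarith
    · intro h
      field_simp
      linarith
  constructor
  · intro h
    obtain ⟨h1, h2⟩ := hM.of_mem_pointSpectrum hz h
    have h3 := hLp.1 h1
    exact ⟨h3, h3.integrable (by norm_num), hint.1 h2⟩
  · rintro ⟨h1, -, h2⟩
    exact hM.mem_pointSpectrum hz (hLp.2 h1) (hint.2 h2)

theorem pointSpectrum_real (hL : 0 < l₁ + l₂) {z : ℂ}
    (hz : z ∈ pointSpectrum (hHat d l₁ l₂ μ φ)) : ((z.re : ℝ) : ℂ) = z :=
  Complex.ext rfl ((isRankOneModel_hHat hL).eigenvalue_im hz).symm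

theorem pointSpectrum_eq_empty_of_free (hL : 0 < l₁ + l₂) (hs : 1 ≤ s l₁ l₂ φ) :
    pointSpectrum (hHat d l₁ l₂ 0 φ) = ∅ := by
  refine Set.eq_empty_of_forall_notMem fun z hz => ?_
  have := ((isRankOneModel_hHat hL).of_mem_pointSpectrum (symbol_ae_ne hL hs z) hz).2
  simp at this

end Translation

/-! ### The degenerate fibre -/

section Degenerate

variable {d : ℕ} {l₁ l₂ μ : ℝ} {φ : Fin d → ℝ}

/-- All hopping coefficients vanish together with their moduli, which leaves a diagonal operator. -/
theorem hHat_apply_of_degenerate (hL : 0 < l₁ + l₂) (hs : s l₁ l₂ φ = 0) (u : L2Z d)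
    (x : Fin d → ℤ) : hHat d l₁ l₂ μ φ u x =
      ((2 * (l₁ + l₂) * d + if x = 0 then μ else 0 : ℝ) : ℂ) * u x := by
  have h1 (k : Fin d) : (l₁ : ℂ) * Complex.exp (-Complex.I * φ k) + l₂ = 0 := by
    have : amplitude l₁ l₂ φ k = 0 := by
      rw [← norm_eq_zero, norm_amplitude hL, r_eq_zero hs]
    rw [amplitude, div_eq_zero_iff] at this
    exact this.resolve_right (by exact_mod_cast hL.ne')
  have h2 (k : Fin d) : (l₁ : ℂ) * Complex.exp (Complex.I * φ k) + l₂ = 0 := by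
    have := congrArg (starRingEnd ℂ) (h1 k)
    simpa [← Complex.exp_conj] using this
  rw [hHat_apply]
  simp only [h1, h2, zero_mul, add_zero, Finset.sum_const_zero, neg_zero, zero_add]
  split_ifs
  · push_cast
    ring
  · push_cast
    ring

theorem hHat_single_of_degenerate (hL : 0 < l₁ + l₂) (hs : s l₁ l₂ φ = 0) (x : Fin d → ℤ) :
    hHat d l₁ l₂ μ φ (lp.single 2 x (1 : ℂ)) =
      ((2 * (l₁ + l₂) * d + if x = 0 then μ else 0 : ℝ) : ℂ) • lp.single 2 x (1 : ℂ) := by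
  refine lp.ext (funext fun y => ?_)
  rw [hHat_apply_of_degenerate hL hs, lp.coeFn_smul, Pi.smul_apply, smul_eq_mul]
  by_cases hxy : y = x
  · rw [hxy]
  · rw [lp.single_apply_ne _ _ _ hxy, mul_zero, mul_zero]

theorem single_ne_zero (x : Fin d → ℤ) : (lp.single 2 x (1 : ℂ) : L2Z d) ≠ 0 := by
  intro h
  have := congrArg (fun u : L2Z d => u x) h
  simp at this

theorem pointSpectrum_of_degenerate (hd : 1 ≤ d) (hL : 0 < l₁ + l₂) (hs : s l₁ l₂ φ = 0) :
    pointSpectrum (hHat d l₁ l₂ μ φ) =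
      {((2 * (l₁ + l₂) * d : ℝ) : ℂ), ((2 * (l₁ + l₂) * d + μ : ℝ) : ℂ)} := by
  have hsingle (x : Fin d → ℤ) :
      ((2 * (l₁ + l₂) * d + if x = 0 then μ else 0 : ℝ) : ℂ)
        ∈ pointSpectrum (hHat d l₁ l₂ μ φ) :=
    mem_pointSpectrum_iff.2 ⟨_, single_ne_zero x,
      sub_eq_zero.2 (hHat_single_of_degenerate hL hs x)⟩
  ext z
  constructor
  · intro hz
    obtain ⟨u, hu, h0⟩ := mem_pointSpectrum_iff.1 hz
    obtain ⟨x, hx⟩ : ∃ x, u x ≠ 0 := by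
      by_contra! h
      exact hu (lp.ext (funext h))
    have h1 : hHat d l₁ l₂ μ φ u x = z * u x := by
      rw [sub_eq_zero.1 h0]
      rfl
    rw [hHat_apply_of_degenerate hL hs] at h1
    have h2 := mul_right_cancel₀ hx h1
    split_ifs at h2
    · exact Or.inr h2.symm
    · rw [add_zero] at h2
      exact Or.inl h2.symm
  · rintro (rfl | rfl)
    · have := hsingle (e ⟨0, hd⟩)
      rwa [if_neg (by
        intro h
        have := congrFun h ⟨0, hd⟩
        simp [e] at this), add_zero] at this
    · simpa using hsingle 0

theorem not_finiteDimensional_of_degenerate (hd : 1 ≤ d) (hL : 0 < l₁ + l₂)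
    (hs : s l₁ l₂ φ = 0) : ¬ FiniteDimensional ℂ (Module.End.eigenspace
      (hHat d l₁ l₂ μ φ : L2Z d →ₗ[ℂ] L2Z d) ((2 * (l₁ + l₂) * d : ℝ) : ℂ)) := by
  intro hfin
  have : Nonempty (Fin d) := ⟨⟨0, hd⟩⟩
  have hinf : Infinite {x : Fin d → ℤ // x ≠ 0} :=
    (Set.infinite_coe_iff (s := {x : Fin d → ℤ | x ≠ 0})).2 (Set.finite_singleton 0).infinite_compl
  let v : {x : Fin d → ℤ // x ≠ 0} → Module.End.eigenspace
      (hHat d l₁ l₂ μ φ : L2Z d →ₗ[ℂ] L2Z d) ((2 * (l₁ + l₂) * d : ℝ) : ℂ) := fun x =>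
    ⟨lp.single 2 x.1 (1 : ℂ), Module.End.mem_eigenspace_iff.2 (by
      have := hHat_single_of_degenerate (μ := μ) hL hs x.1
      rwa [if_neg x.2, add_zero] at this)⟩
  have hv : LinearIndependent ℂ v := by
    refine LinearIndependent.of_comp (Submodule.subtype _) ?_
    rw [linearIndependent_iff']
    intro A g hg x hx
    have h1 := congrArg (fun u : L2Z d => u x.1) hg
    simp only [lp.coeFn_sum, Finset.sum_apply, lp.coeFn_smul, Pi.smul_apply, Function.comp_apply,
      Submodule.subtype_apply, v, lp.coeFn_zero, Pi.zero_apply, smul_eq_mul] at h1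
    rw [Finset.sum_eq_single x] at h1
    · simpa using h1
    · intro y _ hyx
      rw [lp.single_apply_ne _ _ _ (fun h => hyx (Subtype.ext h.symm)), mul_zero]
    · exact fun h => absurd hx h
  exact not_finite_iff_infinite.2 hinf hv.finite

end Degenerate

/-! ### The essential spectrum up to uniqueness of the eigenvalue -/

section Essential

variable {d : ℕ} {l₁ l₂ μ : ℝ} {φ : Fin d → ℝ}

theorem mem_pointSpectrum_of_mem_spectrum (hL : 0 < l₁ + l₂) {z : ℂ}
    (hz : z ∈ spectrum ℂ (hHat d l₁ l₂ μ φ))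
    (hout : z ∉ Complex.ofReal '' Set.Icc (β₁ l₁ l₂ φ) (β₂ l₁ l₂ φ)) :
    z ∈ pointSpectrum (hHat d l₁ l₂ μ φ) := by
  by_contra hp
  obtain ⟨δ, hδ, hgap⟩ := exists_symbol_gap hout
  exact (isRankOneModel_hHat hL).notMem_spectrum continuous_symbol.measurable hδ
    (fun x => hgap _ ⟨_, symbol_mem hL x, rfl⟩) hp hz

/-- Off the band every spectral point is an eigenvalue of finite multiplicity. If there is at most
one, it is isolated, because the closed band keeps a positive distance from it. -/
theorem essentialSpectrum_subset (hL : 0 < l₁ + l₂)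
    (hsub : (pointSpectrum (hHat d l₁ l₂ μ φ) \
      Complex.ofReal '' Set.Icc (β₁ l₁ l₂ φ) (β₂ l₁ l₂ φ)).Subsingleton) :
    essentialSpectrum (hHat d l₁ l₂ μ φ) ⊆
      Complex.ofReal '' Set.Icc (β₁ l₁ l₂ φ) (β₂ l₁ l₂ φ) := by
  rintro z ⟨hz, hdisc⟩
  by_contra hout
  have hp := mem_pointSpectrum_of_mem_spectrum hL hz hout
  obtain ⟨δ, hδ, hgap⟩ := exists_symbol_gap hout
  refine hdisc ⟨hp, ?_, δ, hδ, fun w hw hdist => ?_⟩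
  · refine (isRankOneModel_hHat hL).finiteDimensional_eigenspace
      (Filter.Eventually.of_forall fun x hx => hout ⟨_, symbol_mem hL x, hx⟩) hp
  · have hwout : w ∉ Complex.ofReal '' Set.Icc (β₁ l₁ l₂ φ) (β₂ l₁ l₂ φ) := by
      intro hmem
      rw [dist_eq_norm] at hdist
      exact absurd hdist (not_lt.2 (hgap w hmem))
    exact hsub ⟨mem_pointSpectrum_of_mem_spectrum hL hw hwout, hwout⟩ ⟨hp, hout⟩

theorem exists_near_in_Icc {a b v ε : ℝ} (hab : a < b) (hv : v ∈ Set.Icc a b) (hε : 0 < ε) :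
    ∃ w ∈ Set.Icc a b, w ≠ v ∧ |w - v| < ε := by
  rcases lt_or_ge v b with h | h
  · have h1 : 0 < min (ε / 2) (b - v) := lt_min (by linarith) (by linarith)
    refine ⟨v + min (ε / 2) (b - v), ⟨by linarith [hv.1], ?_⟩, by linarith, ?_⟩
    · linarith [min_le_right (ε / 2) (b - v)]
    · rw [add_sub_cancel_left, abs_of_pos h1]
      linarith [min_le_left (ε / 2) (b - v)]
  · have h1 : 0 < min (ε / 2) (v - a) := lt_min (by linarith) (by linarith)
    refine ⟨v - min (ε / 2) (v - a), ⟨?_, by linarith [hv.2]⟩, by linarith, ?_⟩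
    · linarith [min_le_right (ε / 2) (v - a)]
    · rw [sub_sub_cancel_left, abs_neg, abs_of_pos h1]
      linarith [min_le_left (ε / 2) (v - a)]

/-- A band of positive length has no isolated points. If it shrinks to a point, no direction is
active and that point is an eigenvalue of infinite multiplicity. -/
theorem Icc_subset_essentialSpectrum (hd : 1 ≤ d) (hL : 0 < l₁ + l₂) :
    Complex.ofReal '' Set.Icc (β₁ l₁ l₂ φ) (β₂ l₁ l₂ φ) ⊆
      essentialSpectrum (hHat d l₁ l₂ μ φ) := by
  rintro _ ⟨v, hv, rfl⟩
  refine ⟨Icc_subset_spectrum hd hL ⟨v, hv, rfl⟩, ?_⟩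
  rintro ⟨-, hfin, ε, hε, hiso⟩
  rcases lt_or_ge (β₁ l₁ l₂ φ) (β₂ l₁ l₂ φ) with hlt | hge
  · obtain ⟨w, hw, hne, hwv⟩ := exists_near_in_Icc hlt hv hε
    refine hne (Complex.ofReal_injective (hiso w (Icc_subset_spectrum hd hL ⟨w, hw, rfl⟩) ?_))
    rwa [dist_eq_norm, ← Complex.ofReal_sub, Complex.norm_real]
  · have hsum : ∑ k, r l₁ l₂ (φ k) ≤ 0 := by
      rw [β₁, β₂, mul_le_mul_iff_right₀ (by positivity)] at hge
      linarith
    have hs : s l₁ l₂ φ = 0 := by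
      by_contra hs
      obtain ⟨k, hk⟩ := exists_r_ne_zero (l₁ := l₁) (l₂ := l₂) (φ := φ) (by omega)
      have h1 := Finset.single_le_sum (f := rvec l₁ l₂ φ) (fun k _ => r_nonneg hL _)
        (Finset.mem_univ k)
      exact hk (le_antisymm (h1.trans hsum) (r_nonneg hL _))
    have hzero : ∑ k, r l₁ l₂ (φ k) = 0 := Finset.sum_eq_zero fun k _ => r_eq_zero hs k
    have hveq : v = 2 * (l₁ + l₂) * d := by
      have h1 := hv.1
      have h2 := hv.2
      rw [β₁, hzero] at h1
      rw [β₂, hzero] at h2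
      rw [neg_zero, zero_add] at h1
      rw [zero_add] at h2
      exact le_antisymm h2 h1
    rw [hveq] at hfin
    exact not_finiteDimensional_of_degenerate hd hL hs hfin

end Essential

/-! ### Existence, uniqueness and position of the eigenvalue -/

section Eigenvalues

variable {d : ℕ} {l₁ l₂ μ : ℝ} {φ : Fin d → ℝ}

theorem ResolventMean.outside_or_edge {P : Measure ℝ} {S ρ t : ℝ} [IsProbabilityMeasure P] (h : IsBandLaw P S)
    (hρ : ρ ≠ 0) (hs : ResolventMean P ρ t) :
    (ENNReal.ofReal |ρ| < edgeMean P S ∧ S < |t|) ∨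
      (ENNReal.ofReal |ρ| = edgeMean P S ∧ (t = S ∨ t = -S)) := by
  have key {ρ t : ℝ} (hρ : 0 < ρ) (hs : ResolventMean P ρ t) :
      (ENNReal.ofReal |ρ| < edgeMean P S ∧ S < |t|) ∨
        (ENNReal.ofReal |ρ| = edgeMean P S ∧ t = S) := by
    rw [abs_of_pos hρ]
    rcases (h.le_of_resolventMean hρ hs).lt_or_eq with hlt | heq
    · exact Or.inl ⟨h.lt_edgeMean hlt hρ hs, hlt.trans_le (le_abs_self t)⟩
    · subst heq
      exact Or.inr ⟨((h.resolventMean_edge_iff hρ).1 hs).symm, rfl⟩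
  rcases lt_or_gt_of_ne hρ with hneg | hpos
  · have := key (neg_pos.2 hneg) (h.resolventMean_neg.2 hs)
    rw [abs_neg, abs_neg] at this
    exact this.imp id fun h' => ⟨h'.1, Or.inr (by linarith [h'.2])⟩
  · exact (key hpos hs).imp id fun h' => ⟨h'.1, Or.inl h'.2⟩

theorem exists_outside {P : Measure ℝ} {S ρ : ℝ} [IsProbabilityMeasure P] (h : IsBandLaw P S)
    (hρ : ρ ≠ 0) (hc : ENNReal.ofReal |ρ| < edgeMean P S) :
    ∃ t, S < |t| ∧ MemLp (fun x => (x + t)⁻¹) 2 P ∧ ResolventMean P ρ t := by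
  rcases lt_or_gt_of_ne hρ with hneg | hpos
  · rw [abs_of_neg hneg] at hc
    obtain ⟨t, ht, hs⟩ := h.exists_resolventMean (neg_pos.2 hneg) hc
    refine ⟨-t, ?_, h.memLp_neg.2 (h.memLp_outside ht), ?_⟩
    · rw [abs_neg]
      exact ht.trans_le (le_abs_self t)
    · have := h.resolventMean_neg.2 hs
      rwa [neg_neg] at this
  · rw [abs_of_pos hpos] at hc
    obtain ⟨t, ht, hs⟩ := h.exists_resolventMean hpos hc
    exact ⟨t, ht.trans_le (le_abs_self t), h.memLp_outside ht, hs⟩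

theorem pointSpectrum_eq_singleton (hL : 0 < l₁ + l₂) (hs : 1 ≤ s l₁ l₂ φ) (hμ : μ ≠ 0) {ν : ℝ}
    (hν : (ν : ℂ) ∈ pointSpectrum (hHat d l₁ l₂ μ φ)) :
    pointSpectrum (hHat d l₁ l₂ μ φ) = {(ν : ℂ)} := by
  have hρ : 2 * (l₁ + l₂) / μ ≠ 0 := div_ne_zero (by positivity) hμ
  refine Set.eq_singleton_iff_unique_mem.2 ⟨hν, fun z hz => ?_⟩
  obtain ⟨ν', rfl⟩ : ∃ ν' : ℝ, (ν' : ℂ) = z := ⟨_, pointSpectrum_real hL hz⟩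
  have h1 := ((mem_pointSpectrum_hHat_iff hL hs hμ _).1 hν).2
  have h2 := ((mem_pointSpectrum_hHat_iff hL hs hμ _).1 hz).2
  have h3 := (isBandLaw_rvec hL hs).resolventMean_unique hρ h1 h2
  rw [sub_left_inj, div_left_inj' (by positivity)] at h3
  rw [h3]

theorem essentialSpectrum_hHat (hd : 1 ≤ d) (hL : 0 < l₁ + l₂) :
    essentialSpectrum (hHat d l₁ l₂ μ φ) =
      Complex.ofReal '' Set.Icc (β₁ l₁ l₂ φ) (β₂ l₁ l₂ φ) := by
  refine Set.Subset.antisymm (essentialSpectrum_subset hL ?_) (Icc_subset_essentialSpectrum hd hL)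
  rcases Nat.eq_zero_or_pos (s l₁ l₂ φ) with hs | hs
  · rw [pointSpectrum_of_degenerate hd hL hs]
    have hzero : ∑ k, r l₁ l₂ (φ k) = 0 := Finset.sum_eq_zero fun k _ => r_eq_zero hs k
    have hmem : ((2 * (l₁ + l₂) * d : ℝ) : ℂ) ∈
        Complex.ofReal '' Set.Icc (β₁ l₁ l₂ φ) (β₂ l₁ l₂ φ) :=
      ⟨_, ⟨by simp [β₁, hzero], by simp [β₂, hzero]⟩, rfl⟩
    -- Of the two eigenvalues, the unperturbed one is the band itself, so at most one lies off it.
    rintro z ⟨rfl | rfl, hz⟩ w ⟨rfl | rfl, hw⟩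
    · rfl
    · exact absurd hmem hz
    · exact absurd hmem hw
    · rfl
  · by_cases hμ : μ = 0
    · rw [hμ, pointSpectrum_eq_empty_of_free hL hs]
      simp
    · rintro z ⟨hz, -⟩ w ⟨hw, -⟩
      obtain ⟨ν, rfl⟩ : ∃ ν : ℝ, (ν : ℂ) = z := ⟨_, pointSpectrum_real hL hz⟩
      rw [pointSpectrum_eq_singleton hL hs hμ hz] at hw
      exact hw.symm

theorem oneEigenvalueOffEssential_of_lt (hd : 1 ≤ d) (hL : 0 < l₁ + l₂) (hs : 1 ≤ s l₁ l₂ φ)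
    (hμ : μ ≠ 0) (hlt : ENNReal.ofReal |2 * (l₁ + l₂) / μ| < c d l₁ l₂ φ) :
    OneEigenvalueOffEssential (hHat d l₁ l₂ μ φ) := by
  have hρ : 2 * (l₁ + l₂) / μ ≠ 0 := div_ne_zero (by positivity) hμ
  rw [c_eq_edgeMean] at hlt
  obtain ⟨t, ht, hm, hr⟩ := exists_outside (isBandLaw_rvec hL hs) hρ hlt
  have hν : 2 * (l₁ + l₂) * (t + d) / (2 * (l₁ + l₂)) - d = t := by
    field_simp
    ring
  have hmem : ((2 * (l₁ + l₂) * (t + d) : ℝ) : ℂ) ∈ pointSpectrum (hHat d l₁ l₂ μ φ) := by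
    rw [mem_pointSpectrum_hHat_iff hL hs hμ, hν]
    exact ⟨hm, hr⟩
  refine ⟨_, pointSpectrum_eq_singleton hL hs hμ hmem, ?_⟩
  rw [essentialSpectrum_hHat hd hL]
  rintro ⟨v, ⟨h1, h2⟩, hv⟩
  rw [Complex.ofReal_inj] at hv
  rw [hv, β₁, mul_le_mul_iff_right₀ (by positivity)] at h1
  rw [hv, β₂, mul_le_mul_iff_right₀ (by positivity)] at h2
  exact absurd ht (not_lt.2 (abs_le.2 ⟨by linarith, by linarith⟩))

theorem c_eq_top (hL : 0 < l₁ + l₂) (hs : 1 ≤ s l₁ l₂ φ) (hs2 : s l₁ l₂ φ ≤ 2) :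
    c d l₁ l₂ φ = ⊤ := by
  obtain ⟨k, hk⟩ := exists_r_ne_zero hs
  rw [c_eq_edgeMean]
  exact edgeMean_eq_top (fun k => r_nonneg hL _) hk (s_eq_numNonzero ▸ hs2)

theorem oneEigenvalueOffEssential_of_le_two (hd : 1 ≤ d) (hL : 0 < l₁ + l₂)
    (hs : 1 ≤ s l₁ l₂ φ) (hs2 : s l₁ l₂ φ ≤ 2) (hμ : μ ≠ 0) :
    OneEigenvalueOffEssential (hHat d l₁ l₂ μ φ) :=
  oneEigenvalueOffEssential_of_lt hd hL hs hμ (by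
    rw [c_eq_top hL hs hs2]
    exact ENNReal.ofReal_lt_top)

theorem memLp_edge_iff_s (hL : 0 < l₁ + l₂) (hs : 1 ≤ s l₁ l₂ φ) :
    MemLp (fun x => (x + ∑ k, r l₁ l₂ (φ k))⁻¹) 2 (bandLaw (rvec l₁ l₂ φ)) ↔
      5 ≤ s l₁ l₂ φ := by
  obtain ⟨k, hk⟩ := exists_r_ne_zero hs
  rw [s_eq_numNonzero]
  exact memLp_edge_iff (fun k => r_nonneg hL _) hk

/-- With `c ≤ |ρ|` a solution can only sit at an edge and needs `|ρ| = c`. It is then excluded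
either by a strict inequality or because the kernel is not square integrable for `s ≤ 4`. -/
theorem pointSpectrum_eq_empty (hL : 0 < l₁ + l₂) (hs : 1 ≤ s l₁ l₂ φ) (hμ : μ ≠ 0)
    (hle : c d l₁ l₂ φ ≤ ENNReal.ofReal |2 * (l₁ + l₂) / μ|)
    (h : s l₁ l₂ φ ≤ 4 ∨ c d l₁ l₂ φ < ENNReal.ofReal |2 * (l₁ + l₂) / μ|) :
    pointSpectrum (hHat d l₁ l₂ μ φ) = ∅ := by
  have hρ : 2 * (l₁ + l₂) / μ ≠ 0 := div_ne_zero (by positivity) hμ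
  have hband := isBandLaw_rvec hL hs
  refine Set.eq_empty_of_forall_notMem fun z hz => ?_
  rw [← pointSpectrum_real hL hz, mem_pointSpectrum_hHat_iff hL hs hμ] at hz
  obtain ⟨hm, hr⟩ := hz
  rw [c_eq_edgeMean] at hle h
  rcases ResolventMean.outside_or_edge hband hρ hr with ⟨hlt, -⟩ | ⟨heq, ht⟩
  · exact absurd hle (not_le.2 hlt)
  · rcases h with h4 | hlt
    · have hm' : MemLp (fun x => (x + ∑ k, r l₁ l₂ (φ k))⁻¹) 2 (bandLaw (rvec l₁ l₂ φ)) := by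
        rcases ht with ht | ht <;> rw [ht] at hm
        · exact hm
        · exact hband.memLp_neg.1 hm
      rw [memLp_edge_iff_s hL hs] at hm'
      omega
    · exact hlt.ne' heq

theorem β₂_param (hL : 0 < l₁ + l₂) :
    β₂ l₁ l₂ φ / (2 * (l₁ + l₂)) - d = ∑ k, r l₁ l₂ (φ k) := by
  rw [β₂]
  field_simp
  ring

theorem β₁_param (hL : 0 < l₁ + l₂) :
    β₁ l₁ l₂ φ / (2 * (l₁ + l₂)) - d = -∑ k, r l₁ l₂ (φ k) := by
  rw [β₁]
  field_simp
  ring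

theorem pointSpectrum_eq_upper_edge (hL : 0 < l₁ + l₂) (hs : 5 ≤ s l₁ l₂ φ)
    (hμ : 0 < μ) (heq : ENNReal.ofReal (2 * (l₁ + l₂) / μ) = c d l₁ l₂ φ) :
    pointSpectrum (hHat d l₁ l₂ μ φ) = {(β₂ l₁ l₂ φ : ℂ)} := by
  have hs1 : 1 ≤ s l₁ l₂ φ := by omega
  refine pointSpectrum_eq_singleton hL hs1 hμ.ne' ?_
  rw [mem_pointSpectrum_hHat_iff hL hs1 hμ.ne', β₂_param hL]
  refine ⟨(memLp_edge_iff_s hL hs1).2 hs, ?_⟩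
  rw [(isBandLaw_rvec hL hs1).resolventMean_edge_iff (by positivity), ← c_eq_edgeMean, heq]

theorem pointSpectrum_eq_lower_edge (hL : 0 < l₁ + l₂) (hs : 5 ≤ s l₁ l₂ φ)
    (hμ : μ < 0) (heq : ENNReal.ofReal (-(2 * (l₁ + l₂) / μ)) = c d l₁ l₂ φ) :
    pointSpectrum (hHat d l₁ l₂ μ φ) = {(β₁ l₁ l₂ φ : ℂ)} := by
  have hs1 : 1 ≤ s l₁ l₂ φ := by omega
  have hband := isBandLaw_rvec hL hs1
  have hρ : 0 < -(2 * (l₁ + l₂) / μ) := neg_pos.2 (div_neg_of_pos_of_neg (by positivity) hμ)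
  refine pointSpectrum_eq_singleton hL hs1 hμ.ne ?_
  rw [mem_pointSpectrum_hHat_iff hL hs1 hμ.ne, β₁_param hL]
  refine ⟨hband.memLp_neg.2 ((memLp_edge_iff_s hL hs1).2 hs), ?_⟩
  rw [← hband.resolventMean_neg, neg_neg, hband.resolventMean_edge_iff hρ, ← c_eq_edgeMean, heq]

theorem eigenvalue_properties (hL : 0 < l₁ + l₂) (hs : 1 ≤ s l₁ l₂ φ) (hμ : μ ≠ 0) {ν : ℝ}
    (hν : (ν : ℂ) ∈ pointSpectrum (hHat d l₁ l₂ μ φ)) :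
    (0 < μ → β₂ l₁ l₂ φ ≤ ν) ∧ (μ < 0 → ν ≤ β₁ l₁ l₂ φ) ∧ SolvesEigenEquation l₁ l₂ μ φ ν ∧
      ∀ ν' : ℝ, SolvesEigenEquation l₁ l₂ μ φ ν' → ν' = ν := by
  have hρ : 2 * (l₁ + l₂) / μ ≠ 0 := div_ne_zero (by positivity) hμ
  have h2L : 0 < 2 * (l₁ + l₂) := by positivity
  have hband := isBandLaw_rvec hL hs
  have hr := ((mem_pointSpectrum_hHat_iff hL hs hμ ν).1 hν).2
  refine ⟨fun hpos => ?_, fun hneg => ?_, (solvesEigenEquation_iff ν).2 hr, fun ν' hν' => ?_⟩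
  · have h1 := hband.le_of_resolventMean (div_pos h2L hpos) hr
    rw [← β₂_param hL] at h1
    exact (div_le_div_iff_of_pos_right h2L).1 (by linarith)
  · have h1 := hband.le_of_resolventMean (neg_pos.2 (div_neg_of_pos_of_neg h2L hneg))
      (hband.resolventMean_neg.2 hr)
    have h2 := β₁_param (φ := φ) hL
    exact (div_le_div_iff_of_pos_right h2L).1 (by linarith)
  · have h1 := hband.resolventMean_unique hρ ((solvesEigenEquation_iff ν').1 hν') hr
    rwa [sub_left_inj, div_left_inj' h2L.ne'] at h1

end Eigenvalues

theorem coe_eq_coe_ofReal {x : ℝ} (hx : 0 ≤ x) : (x : EReal) = (ENNReal.ofReal x : EReal) := by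
  rw [EReal.coe_ennreal_ofReal, max_eq_left (by exact_mod_cast hx)]

end LatticePair

end

/-! ### Assembly of the cases -/

theorem theorem2 (d : ℕ) (hd : 1 ≤ d) (l₁ l₂ μ : ℝ) (hl₁ : 0 < l₁) (hl₂ : 0 < l₂)
    (φ : Fin d → ℝ) (hφ : φ ∈ LatticePair.torus d) :
    -- essential spectrum
    LatticePair.essentialSpectrum (LatticePair.hHat d l₁ l₂ μ φ) =
      Complex.ofReal '' Set.Icc (LatticePair.β₁ l₁ l₂ φ) (LatticePair.β₂ l₁ l₂ φ) ∧
    -- the degenerate fibre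
    (LatticePair.s l₁ l₂ φ = 0 →
      LatticePair.pointSpectrum (LatticePair.hHat d l₁ l₂ μ φ) =
        {((2 * (l₁ + l₂) * d : ℝ) : ℂ), ((2 * (l₁ + l₂) * d + μ : ℝ) : ℂ)}) ∧
    -- no interaction
    (1 ≤ LatticePair.s l₁ l₂ φ → μ = 0 →
      LatticePair.pointSpectrum (LatticePair.hHat d l₁ l₂ μ φ) = ∅) ∧
    -- interaction
    (1 ≤ LatticePair.s l₁ l₂ φ → μ ≠ 0 →
      -- dimensions 1 and 2
      (d = 1 ∨ d = 2 →
        LatticePair.OneEigenvalueOffEssential (LatticePair.hHat d l₁ l₂ μ φ)) ∧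
      -- dimensions 3 and 4
      (d = 3 ∨ d = 4 →
        (l₁ = l₂ ∧ LatticePair.s l₁ l₂ φ ≤ 2 →
          LatticePair.OneEigenvalueOffEssential (LatticePair.hHat d l₁ l₂ μ φ)) ∧
        (l₁ ≠ l₂ ∨ 3 ≤ LatticePair.s l₁ l₂ φ →
          (((|2 * (l₁ + l₂) / μ| : ℝ) : EReal) < (LatticePair.c d l₁ l₂ φ : EReal) →
            LatticePair.OneEigenvalueOffEssential (LatticePair.hHat d l₁ l₂ μ φ)) ∧
          ((LatticePair.c d l₁ l₂ φ : EReal) ≤ ((|2 * (l₁ + l₂) / μ| : ℝ) : EReal) →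
            LatticePair.pointSpectrum (LatticePair.hHat d l₁ l₂ μ φ) = ∅))) ∧
      -- dimensions at least 5
      (5 ≤ d →
        (l₁ = l₂ ∧ LatticePair.s l₁ l₂ φ ≤ 2 →
          LatticePair.OneEigenvalueOffEssential (LatticePair.hHat d l₁ l₂ μ φ)) ∧
        (l₁ = l₂ ∧ (LatticePair.s l₁ l₂ φ = 3 ∨ LatticePair.s l₁ l₂ φ = 4) →
          (((|2 * (l₁ + l₂) / μ| : ℝ) : EReal) < (LatticePair.c d l₁ l₂ φ : EReal) →
            LatticePair.OneEigenvalueOffEssential (LatticePair.hHat d l₁ l₂ μ φ)) ∧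
          ((LatticePair.c d l₁ l₂ φ : EReal) ≤ ((|2 * (l₁ + l₂) / μ| : ℝ) : EReal) →
            LatticePair.pointSpectrum (LatticePair.hHat d l₁ l₂ μ φ) = ∅)) ∧
        (l₁ ≠ l₂ ∨ 5 ≤ LatticePair.s l₁ l₂ φ →
          (((|2 * (l₁ + l₂) / μ| : ℝ) : EReal) < (LatticePair.c d l₁ l₂ φ : EReal) →
            LatticePair.OneEigenvalueOffEssential (LatticePair.hHat d l₁ l₂ μ φ)) ∧
          (((2 * (l₁ + l₂) / μ : ℝ) : EReal) = (LatticePair.c d l₁ l₂ φ : EReal) →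
            LatticePair.pointSpectrum (LatticePair.hHat d l₁ l₂ μ φ) =
              {(LatticePair.β₂ l₁ l₂ φ : ℂ)}) ∧
          (((-(2 * (l₁ + l₂) / μ) : ℝ) : EReal) = (LatticePair.c d l₁ l₂ φ : EReal) →
            LatticePair.pointSpectrum (LatticePair.hHat d l₁ l₂ μ φ) =
              {(LatticePair.β₁ l₁ l₂ φ : ℂ)}) ∧
          ((LatticePair.c d l₁ l₂ φ : EReal) < ((|2 * (l₁ + l₂) / μ| : ℝ) : EReal) →
            LatticePair.pointSpectrum (LatticePair.hHat d l₁ l₂ μ φ) = ∅))) ∧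
      -- in all cases: position of the eigenvalue, and the equation that it solves
      (∀ ν : ℝ, (ν : ℂ) ∈ LatticePair.pointSpectrum (LatticePair.hHat d l₁ l₂ μ φ) →
        (0 < μ → LatticePair.β₂ l₁ l₂ φ ≤ ν) ∧
        (μ < 0 → ν ≤ LatticePair.β₁ l₁ l₂ φ) ∧
        LatticePair.SolvesEigenEquation l₁ l₂ μ φ ν ∧
        ∀ ν' : ℝ, LatticePair.SolvesEigenEquation l₁ l₂ μ φ ν' → ν' = ν)) := by
  have hL : 0 < l₁ + l₂ := add_pos hl₁ hl₂
  have hρ := LatticePair.coe_eq_coe_ofReal (abs_nonneg (2 * (l₁ + l₂) / μ))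
  rw [hρ]
  simp only [EReal.coe_ennreal_lt_coe_ennreal_iff, EReal.coe_ennreal_le_coe_ennreal_iff]
  refine ⟨LatticePair.essentialSpectrum_hHat hd hL, LatticePair.pointSpectrum_of_degenerate hd hL,
    fun hs hμ => hμ ▸ LatticePair.pointSpectrum_eq_empty_of_free hL hs, fun hs hμ => ?_⟩
  have hsd : LatticePair.s l₁ l₂ φ ≤ d := LatticePair.s_le
  have hE := fun hlt => LatticePair.oneEigenvalueOffEssential_of_lt (φ := φ) hd hL hs hμ hlt
  have hE2 := fun h2 => LatticePair.oneEigenvalueOffEssential_of_le_two (φ := φ) hd hL hs h2 hμ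
  have hempty := LatticePair.pointSpectrum_eq_empty (φ := φ) hL hs hμ
  -- The bound `s ≤ d` settles low dimensions: `s ≤ 2` for `d ≤ 2`, and `s ≤ 4` for `d ≤ 4`.
  refine ⟨fun h12 => hE2 (by omega), fun h34 => ⟨fun h => hE2 h.2, fun _ => ⟨hE, fun hle =>
    hempty hle (Or.inl (by omega))⟩⟩, fun h5 => ⟨fun h => hE2 h.2, fun h => ⟨hE, fun hle =>
    hempty hle (Or.inl (by omega))⟩, fun h => ?_⟩, fun ν hν =>
    LatticePair.eigenvalue_properties hL hs hμ hν⟩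
  have hs5 : 5 ≤ LatticePair.s l₁ l₂ φ := by
    rcases h with hne | h
    · rwa [LatticePair.s_eq_of_ne hl₁ hl₂ hne]
    · exact h
  -- As `c` is nonnegative, equality of `ρ` or `-ρ` with `c` determines the sign of `μ`, and with it
  -- the edge.
  have hnn {x : ℝ} (hx : (x : EReal) = (LatticePair.c d l₁ l₂ φ : EReal)) : 0 ≤ x := by
    have : (0 : EReal) ≤ x := hx ▸ EReal.coe_ennreal_nonneg _
    exact_mod_cast this
  refine ⟨hE, fun heq => ?_, fun heq => ?_, fun hlt => hempty hlt.le (Or.inr hlt)⟩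
  · have h0 := hnn heq
    rw [LatticePair.coe_eq_coe_ofReal h0, EReal.coe_ennreal_eq_coe_ennreal_iff] at heq
    refine LatticePair.pointSpectrum_eq_upper_edge hL hs5 (lt_of_le_of_ne ?_ hμ.symm) heq
    by_contra! hneg
    exact absurd h0 (not_le.2 (div_neg_of_pos_of_neg (by positivity) hneg))
  · have h0 := hnn heq
    rw [LatticePair.coe_eq_coe_ofReal h0, EReal.coe_ennreal_eq_coe_ennreal_iff] at heq
    refine LatticePair.pointSpectrum_eq_lower_edge hL hs5 (lt_of_le_of_ne ?_ hμ) heq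
    by_contra! hpos
    have : 0 < 2 * (l₁ + l₂) / μ := by positivity
    linarith
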